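/- Lemma 2.2 (lem.quaterniondescend): Let $K$ be a field of characteristic different from $2$, let $L/K$ be a field extension of degree $2$, and let $\alpha\in\mathrm{Br}(L)$ be the Brauer class of a (possibly split) quaternion algebra over $L$. Then $\mathrm{cores}_{L/K}(\alpha)=0$ in $\mathrm{Br}(K)$ if and only if there is a quaternion algebra over $K$, with Brauer class $\beta\in\mathrm{Br}(K)$, such that $\alpha=\mathrm{res}_{L/K}(\beta)$. Here a quaternion algebra over a field $F$ of characteristic different from $2$ is an $F$-algebra with an $F$-basis $1,i,j,ij$ such that $i^2=a$, $j^2=b$, $ij=-ji$ for some $a,b\in F^\times$. The restriction $\mathrm{res}_{L/K}\colon\mathrm{Br}(K)\to\mathrm{Br}(L)$ is $[A]\mapsto[L\otimes_K A]$. The corestriction $\mathrm{cores}_{L/K}\colon\mathrm{Br}(L)\to\mathrm{Br}(K)$ sends the class of a central simple $L$-algebra $A$ to the class of its norm algebra, the $K$-algebra of elements of ${}^{\iota}A\otimes_L A$ fixed by the switch map $a\otimes b\mapsto b\otimes a$, where $\iota$ is the nontrivial $K$-automorphism of $L$ and ${}^{\iota}A$ is $A$ with the $L$-action twisted by $\iota$.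 -/

import Mathlib

open scoped TensorProduct

universe u

namespace BrauerCores

section Tensor

variable {K A B : Type*} [Field K] [Ring A] [Algebra K A] [Ring B] [Algebra K B]

theorem exists_eq_one_tmul [Algebra.IsCentral K A] (z : A ⊗[K] B)
    (hz : ∀ a : A, (a ⊗ₜ[K] (1 : B)) * z = z * (a ⊗ₜ[K] (1 : B))) :
    ∃ b : B, z = (1 : A) ⊗ₜ[K] b := by
  have h1 : z ∈ Subalgebra.centralizer K
      ((Algebra.TensorProduct.includeLeft : A →ₐ[K] A ⊗[K] B).range : Set (A ⊗[K] B)) := by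
    rw [Subalgebra.mem_centralizer_iff]
    rintro _ ⟨a, rfl⟩
    exact hz a
  rw [Subalgebra.centralizer_coe_range_includeLeft_eq_center_tensorProduct] at h1
  obtain ⟨w, rfl⟩ := h1
  induction w using TensorProduct.induction_on with
  | zero => exact ⟨0, by simp⟩
  | tmul a b =>
    obtain ⟨k, hk⟩ := (Algebra.IsCentral.mem_center_iff K (x := (a : A))).1 a.2
    refine ⟨k • b, ?_⟩
    simp [hk, Algebra.algebraMap_eq_smul_one, TensorProduct.smul_tmul]
  | add x y hx hy =>
    have aux : ∀ w : (Subalgebra.center K A) ⊗[K] B, ∀ a : A, (a ⊗ₜ[K] (1 : B)) *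
        ((Algebra.TensorProduct.map (Subalgebra.center K A).val (AlgHom.id K B)) w) =
        ((Algebra.TensorProduct.map (Subalgebra.center K A).val (AlgHom.id K B)) w) *
        (a ⊗ₜ[K] (1 : B)) := by
      intro w a
      induction w using TensorProduct.induction_on with
      | zero => simp
      | tmul c b => simp [(Subalgebra.mem_center_iff.1 c.2 a)]
      | add x y hx hy => rw [map_add, mul_add, add_mul, hx, hy]
    obtain ⟨b, hb⟩ := hx (aux x)
    obtain ⟨c, hc⟩ := hy (aux y)
    refine ⟨b + c, ?_⟩
    rw [TensorProduct.tmul_add, ← hb, ← hc]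
    exact map_add _ _ _

theorem one_tmul_injective [Nontrivial A] :
    Function.Injective (fun b : B => (1 : A) ⊗ₜ[K] b) :=
  Algebra.TensorProduct.includeRight_injective (FaithfulSMul.algebraMap_injective K A)

theorem isCentral_tensor [Nontrivial A] [Algebra.IsCentral K A] [Algebra.IsCentral K B] :
    Algebra.IsCentral K (A ⊗[K] B) where
  out z hz := by
    rw [Subalgebra.mem_center_iff] at hz
    obtain ⟨b, rfl⟩ := exists_eq_one_tmul z (fun a => hz _)
    have hb : b ∈ Subalgebra.center K B := by
      rw [Subalgebra.mem_center_iff]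
      intro c
      apply one_tmul_injective (K := K) (A := A)
      simpa using hz ((1 : A) ⊗ₜ c)
    obtain ⟨k, rfl⟩ := (Algebra.IsCentral.mem_center_iff K).1 hb
    refine ⟨k, ?_⟩
    change algebraMap K (A ⊗[K] B) k = _
    simp [Algebra.algebraMap_eq_smul_one, Algebra.TensorProduct.one_def]

theorem isSimpleRing_tensor [Algebra.IsCentral K A] [IsSimpleRing A] [IsSimpleRing B] :
    IsSimpleRing (A ⊗[K] B) := by
  have : Nontrivial (A ⊗[K] B) :=
    (one_tmul_injective (K := K) (A := A) (B := B)).nontrivial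
  refine .of_eq_bot_or_eq_top fun I => ?_
  rw [or_iff_not_imp_left]
  intro hI
  rw [← TwoSidedIdeal.one_mem_iff]
  let ℬ := Module.Free.chooseBasis K B
  let bas := Algebra.TensorProduct.basis A ℬ
  have hr : ∀ (x : A ⊗[K] B) (a : A) i,
      bas.repr (x * (a ⊗ₜ 1)) i = bas.repr x i * a := by
    intro x a i
    induction x using TensorProduct.induction_on with
    | zero => simp
    | tmul c b =>
      simp [bas, Algebra.TensorProduct.basis_repr_tmul, mul_assoc, Algebra.commutes]
    | add x y hx hy => simp [add_mul, hx, hy]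
  have hl : ∀ (x : A ⊗[K] B) (a : A) i,
      bas.repr ((a ⊗ₜ 1) * x) i = a * bas.repr x i := by
    intro x a i
    induction x using TensorProduct.induction_on with
    | zero => simp
    | tmul c b =>
      simp [bas, Algebra.TensorProduct.basis_repr_tmul, mul_assoc]
    | add x y hx hy => simp [mul_add, hx, hy]
  have hex : ∃ n, ∃ x ∈ I, x ≠ 0 ∧ (bas.repr x).support.card = n := by
    obtain ⟨x, hx1, hx2 : x ≠ 0⟩ := SetLike.exists_of_lt (bot_lt_iff_ne_bot.mpr hI : ⊥ < I)
    exact ⟨_, x, hx1, hx2, rfl⟩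
  classical
  obtain ⟨x, hxI, hx0, hxn⟩ := Nat.find_spec hex
  have hmin : ∀ y ∈ I, (bas.repr y).support.card < (bas.repr x).support.card → y = 0 := by
    intro y hy hlt
    by_contra h
    exact Nat.find_min hex (hxn ▸ hlt) ⟨y, hy, h, rfl⟩
  obtain ⟨i, hi⟩ : ∃ i, bas.repr x i ≠ 0 := by
    by_contra! h
    exact hx0 (bas.repr.map_eq_zero_iff.1 (Finsupp.ext h))
  let J : TwoSidedIdeal A := TwoSidedIdeal.mk'
    {a | ∃ y ∈ I, (∀ j, bas.repr x j = 0 → bas.repr y j = 0) ∧ bas.repr y i = a}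
    ⟨0, I.zero_mem, by simp, by simp⟩
    (by
      rintro _ _ ⟨y, hy, h, rfl⟩ ⟨z, hz, h', rfl⟩
      exact ⟨y + z, I.add_mem hy hz, fun j hj => by simp [h j hj, h' j hj], by simp⟩)
    (by
      rintro _ ⟨y, hy, h, rfl⟩
      exact ⟨-y, I.neg_mem hy, fun j hj => by simp [h j hj], by simp⟩)
    (by
      rintro a _ ⟨y, hy, h, rfl⟩
      exact ⟨(a ⊗ₜ 1) * y, I.mul_mem_left _ _ hy, fun j hj => by rw [hl, h j hj, mul_zero], hl _ _ _⟩)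
    (by
      rintro _ a ⟨y, hy, h, rfl⟩
      exact ⟨y * (a ⊗ₜ 1), I.mul_mem_right _ _ hy, fun j hj => by rw [hr, h j hj, zero_mul], hr _ _ _⟩)
  have hJ : (1 : A) ∈ J := IsSimpleRing.one_mem_of_ne_zero_mem J hi
    ((TwoSidedIdeal.mem_mk' _ _ _ _ _ _ _).2 ⟨x, hxI, fun _ h => h, rfl⟩)
  obtain ⟨y, hyI, hy, hy1⟩ := (TwoSidedIdeal.mem_mk' _ _ _ _ _ _ _).1 hJ
  have hcomm : ∀ a : A, (a ⊗ₜ[K] (1 : B)) * y = y * (a ⊗ₜ[K] (1 : B)) := by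
    intro a
    rw [← sub_eq_zero]
    refine hmin _ (I.sub_mem (I.mul_mem_left _ _ hyI) (I.mul_mem_right _ _ hyI)) ?_
    refine Finset.card_lt_card (Finset.ssubset_iff_of_subset ?_ |>.2 ⟨i, by simpa using hi, ?_⟩)
    · intro j hj
      rw [Finsupp.mem_support_iff] at hj ⊢
      contrapose! hj
      rw [map_sub, Finsupp.sub_apply, hl, hr, hy j hj]
      simp
    · rw [Finsupp.notMem_support_iff, map_sub, Finsupp.sub_apply, hl, hr, hy1]
      simp
  obtain ⟨b, rfl⟩ := exists_eq_one_tmul y hcomm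
  have hb : b ≠ 0 := by
    rintro rfl
    simp at hy1
  have := IsSimpleRing.one_mem_of_ne_zero_mem
    (I.comap (Algebra.TensorProduct.includeRight : B →ₐ[K] A ⊗[K] B)) hb
    (by rw [TwoSidedIdeal.mem_comap]; exact hyI)
  rw [TwoSidedIdeal.mem_comap] at this
  rw [Algebra.TensorProduct.one_def]
  simpa using this

theorem isCentral_baseChange (L : Type*) [Field L] [Algebra K L] [Algebra.IsCentral K A] :
    Algebra.IsCentral L (L ⊗[K] A) where
  out z hz := by
    rw [Subalgebra.mem_center_iff] at hz
    obtain ⟨l, hl⟩ := exists_eq_one_tmul (Algebra.TensorProduct.comm K L A z) (fun a => by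
      simpa using congrArg (Algebra.TensorProduct.comm K L A) (hz (1 ⊗ₜ a)))
    refine ⟨l, ?_⟩
    apply (Algebra.TensorProduct.comm K L A).injective
    rw [hl]
    simp

end Tensor

section Abstract

/-- An isomorphism compatible with two endomorphisms restricts to their fixed subalgebras. -/
noncomputable def fixedEquiv {K T T' : Type*} [Field K] [Ring T] [Algebra K T] [Ring T'] [Algebra K T']
    (s : T →ₐ[K] T) (s' : T' →ₐ[K] T') (e : T ≃ₐ[K] T') (h : ∀ t, e (s t) = s' (e t)) :
    AlgHom.equalizer s (AlgHom.id K T) ≃ₐ[K] AlgHom.equalizer s' (AlgHom.id K T') :=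
  AlgEquiv.ofAlgHom
    ((e.toAlgHom.comp (Subalgebra.val _)).codRestrict _ (fun x => by
      have hx : s x.1 = x.1 := x.2
      change s' (e x.1) = e x.1
      rw [← h, hx]))
    ((e.symm.toAlgHom.comp (Subalgebra.val _)).codRestrict _ (fun x => by
      have hx : s' x.1 = x.1 := x.2
      change s (e.symm x.1) = e.symm x.1
      apply e.injective
      rw [h, e.apply_symm_apply, hx]))
    (by ext x; simp)
    (by ext x; simp)

/-- Matrices fixed by an entrywise endomorphism are the matrices with fixed entries. -/
noncomputable def fixedMatrix {K T m : Type*} [Field K] [Ring T] [Algebra K T] [Fintype m] [DecidableEq m]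
    (s : T →ₐ[K] T) :
    AlgHom.equalizer (s.mapMatrix (m := m)) (AlgHom.id K _) ≃ₐ[K]
      Matrix m m (AlgHom.equalizer s (AlgHom.id K T)) :=
  AlgEquiv.symm <| AlgEquiv.ofBijective
    (((AlgHom.equalizer s (AlgHom.id K T)).val.mapMatrix (m := m)).codRestrict _ (fun x => by
      change s.mapMatrix _ = _
      ext i j
      exact (x i j).2))
    ⟨fun x y h => by
      ext i j
      exact congrFun (congrFun (congrArg Subtype.val h) i) j,
     fun x => ⟨fun i j => ⟨x.1 i j, congrFun (congrFun x.2 i) j⟩, rfl⟩⟩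

/-- The inner automorphism `x ↦ P * x * Q`, where `Q` is the inverse of `P`. -/
noncomputable def innerEquiv {K R : Type*} [Field K] [Ring R] [Algebra K R] (P Q : R) (h : P * Q = 1)
    (h' : Q * P = 1) : R ≃ₐ[K] R :=
  AlgEquiv.ofAlgHom
    { toFun := fun x => P * x * Q
      map_one' := by rw [mul_one, h]
      map_mul' := fun x y => by
        rw [show P * x * Q * (P * y * Q) = P * x * (Q * P) * y * Q by noncomm_ring, h']
        noncomm_ring
      map_zero' := by simp
      map_add' := fun x y => by noncomm_ring
      commutes' := fun k => by rw [← Algebra.commutes, mul_assoc, h, mul_one] }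
    { toFun := fun x => Q * x * P
      map_one' := by rw [mul_one, h']
      map_mul' := fun x y => by
        rw [show Q * x * P * (Q * y * P) = Q * x * (P * Q) * y * P by noncomm_ring, h]
        noncomm_ring
      map_zero' := by simp
      map_add' := fun x y => by noncomm_ring
      commutes' := fun k => by rw [← Algebra.commutes, mul_assoc, h', mul_one] }
    (by
      ext x
      change P * (Q * x * P) * Q = x
      rw [show P * (Q * x * P) * Q = (P * Q) * x * (P * Q) by noncomm_ring, h]
      simp)
    (by
      ext x
      change Q * (P * x * Q) * P = x
      rw [show Q * (P * x * Q) * P = (Q * P) * x * (Q * P) by noncomm_ring, h']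
      simp)

theorem fixed_twist {K L R : Type*} [Field K] [Field L] [Ring R] [Algebra K R] [Algebra L R]
    (σ : L →+* L) (S S' : R →ₐ[K] R)
    (hS : ∀ l, S (algebraMap L R l) = algebraMap L R (σ l)) (W : R)
    (hW : W * W = 1) (hSW : S W = W) (hS' : ∀ x, S' x = W * S x * W)
    (hσ : ∀ l, σ (σ l) = l) (u : L) (hu : u ^ 2 ≠ σ u ^ 2) :
    Nonempty (AlgHom.equalizer S (AlgHom.id K R) ≃ₐ[K]
      AlgHom.equalizer S' (AlgHom.id K R)) := by
  set a := algebraMap L R u with ha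
  set b := algebraMap L R (σ u) with hb
  have hcomm : a * b = b * a := by rw [ha, Algebra.commutes]
  have haW : a * W = W * a := Algebra.commutes _ _
  have hbW : b * W = W * b := Algebra.commutes _ _
  set c := algebraMap L R (u ^ 2 - σ u ^ 2)⁻¹ with hc
  have hcc : ∀ x, c * x = x * c := fun x => Algebra.commutes _ _
  have hc1 : c * (a * a - b * b) = 1 := by
    rw [hc, ha, hb, ← map_mul, ← map_mul, ← map_sub, ← map_mul, ← pow_two, ← pow_two,
      inv_mul_cancel₀ (sub_ne_zero.2 hu), map_one]
  have hPQ0 : (a + b * W) * (a - b * W) = a * a - b * b := by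
    have e1 : b * W * (b * W) = b * b := by
      rw [hbW, mul_assoc, ← mul_assoc b, hbW, ← mul_assoc, ← mul_assoc, hW, one_mul]
    have e2 : b * W * a = a * (b * W) := by
      rw [mul_assoc, ← haW, ← mul_assoc, ← mul_assoc, hcomm]
    rw [add_mul, mul_sub, mul_sub, e1, e2]
    abel
  have hQP0 : (a - b * W) * (a + b * W) = a * a - b * b := by
    have e1 : b * W * (b * W) = b * b := by
      rw [hbW, mul_assoc, ← mul_assoc b, hbW, ← mul_assoc, ← mul_assoc, hW, one_mul]
    have e2 : b * W * a = a * (b * W) := by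
      rw [mul_assoc, ← haW, ← mul_assoc, ← mul_assoc, hcomm]
    rw [sub_mul, mul_add, mul_add, e1, e2]
    abel
  set P := a + b * W with hP
  set Q := c * (a - b * W) with hQ
  have hPQ : P * Q = 1 := by
    rw [hQ, hcc, ← mul_assoc, hPQ0, ← hcc, hc1]
  have hQP : Q * P = 1 := by
    rw [hQ, mul_assoc, hQP0, hc1]
  have hSP : S P = P * W := by
    rw [hP, map_add, map_mul, hSW, ha, hb, hS, hS, hσ, ← ha, ← hb, add_mul, mul_assoc, hW,
      mul_one, add_comm]
  have hPW : P * W = W * P := by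
    rw [hP, add_mul, mul_add, haW, hbW, mul_assoc, hbW]
  have hSQ : S Q = W * Q := by
    have h1 : S Q * (P * W) = 1 := by rw [← hSP, ← map_mul, hQP, map_one]
    have h2 : (P * W) * (W * Q) = 1 := by
      rw [show P * W * (W * Q) = P * (W * W) * Q by noncomm_ring, hW, mul_one, hPQ]
    exact left_inv_eq_right_inv h1 h2
  refine ⟨fixedEquiv S S' (innerEquiv P Q hPQ hQP) fun t => ?_⟩
  change P * S t * Q = S' (P * t * Q)
  rw [hS', map_mul, map_mul, hSP, hSQ]
  rw [show W * (P * W * S t * (W * Q)) * W = (W * P) * W * S t * W * (Q * W) by noncomm_ring]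
  have hQW : Q * W = W * Q := by
    calc Q * W = Q * W * (P * Q) := by rw [hPQ, mul_one]
      _ = Q * (W * P) * Q := by noncomm_ring
      _ = (Q * P) * W * Q := by rw [← hPW]; noncomm_ring
      _ = W * Q := by rw [hQP, one_mul]
  rw [← hPW, hQW]
  rw [show P * W * W * S t * W * (W * Q) = P * (W * W) * S t * (W * W) * Q by noncomm_ring, hW]
  simp

end Abstract


section Conjugation

variable (K L : Type u) [Field K] [Field L] [Algebra K L]

theorem isSeparable_of_quadratic [NeZero (2 : K)] [Algebra.IsQuadraticExtension K L] :
    Algebra.IsSeparable K L where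
  isSeparable' x := by
    have hx : IsIntegral K x := Algebra.IsIntegral.isIntegral x
    rw [IsSeparable, Polynomial.separable_iff_derivative_ne_zero (minpoly.irreducible hx)]
    have hd : (minpoly K x).natDegree ∣ 2 := by
      rw [← Algebra.IsQuadraticExtension.finrank_eq_two K L]
      exact minpoly.degree_dvd hx
    have hd' : ((minpoly K x).natDegree : K) ≠ 0 := by
      rcases (Nat.dvd_prime Nat.prime_two).1 hd with h | h <;> rw [h]
      · simp
      · exact_mod_cast NeZero.ne (2 : K)
    intro h0
    have hpos := minpoly.natDegree_pos hx
    have := congrArg (fun p => p.coeff ((minpoly K x).natDegree - 1)) h0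
    simp only [Polynomial.coeff_derivative, Polynomial.coeff_zero, Nat.sub_add_cancel hpos] at this
    rw [Polynomial.coeff_natDegree, (minpoly.monic hx).leadingCoeff, one_mul] at this
    apply hd'
    rw [← this, ← Nat.cast_succ, Nat.succ_eq_add_one, Nat.sub_add_cancel hpos]

theorem card_gal_of_quadratic [NeZero (2 : K)] [Algebra.IsQuadraticExtension K L] :
    Nat.card (L ≃ₐ[K] L) = 2 := by
  have := isSeparable_of_quadratic K L
  rw [IsGalois.card_aut_eq_finrank, Algebra.IsQuadraticExtension.finrank_eq_two K L]

theorem exists_conj [NeZero (2 : K)] [Algebra.IsQuadraticExtension K L] :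
    ∃ σ : L ≃ₐ[K] L, σ ≠ 1 := by
  have : Nontrivial (L ≃ₐ[K] L) :=
    (Nat.card_eq_two_iff.1 (card_gal_of_quadratic K L)).elim fun x ⟨y, h, _⟩ => ⟨x, y, h⟩
  exact exists_ne 1

/-- The nontrivial `K`-automorphism of the quadratic extension `L` (unique by `eq_conj`). -/
noncomputable def conj [NeZero (2 : K)] [Algebra.IsQuadraticExtension K L] : L ≃ₐ[K] L :=
  (exists_conj K L).choose

variable [NeZero (2 : K)] [Algebra.IsQuadraticExtension K L]

theorem conj_ne_one : conj K L ≠ 1 := (exists_conj K L).choose_spec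

theorem conj_conj (x : L) : conj K L (conj K L x) = x := by
  have h : conj K L ^ 2 = 1 := by
    rw [← card_gal_of_quadratic K L]
    exact pow_card_eq_one'
  simpa [pow_two] using DFunLike.congr_fun h x

theorem eq_conj (σ : L ≃ₐ[K] L) (hσ : σ ≠ 1) : σ = conj K L := by
  have h2 := card_gal_of_quadratic K L
  rw [Nat.card_eq_two_iff' 1] at h2
  exact h2.unique hσ (conj_ne_one K L)

theorem mem_range_of_conj_eq (x : L) (hx : conj K L x = x) : ∃ k, algebraMap K L k = x := by
  have := isSeparable_of_quadratic K L
  rw [← Set.mem_range, IsGalois.mem_range_algebraMap_iff_fixed]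
  intro σ
  by_cases h : σ = 1
  · simp [h]
  · rw [eq_conj K L σ h, hx]

theorem two_ne_zero_top (K L : Type u) [Field K] [Field L] [Algebra K L] [NeZero (2 : K)] :
    (2 : L) ≠ 0 := by
  rw [← map_ofNat (algebraMap K L) 2]
  exact (map_ne_zero (algebraMap K L)).2 (NeZero.ne (2 : K))

theorem exists_conj_eq_neg : ∃ v : L, v ≠ 0 ∧ conj K L v = -v := by
  obtain ⟨x, hx⟩ : ∃ x, conj K L x ≠ x := by
    by_contra! h
    exact conj_ne_one K L (AlgEquiv.ext h)
  refine ⟨x - conj K L x, sub_ne_zero.2 hx.symm, ?_⟩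
  rw [map_sub, conj_conj]
  ring

theorem exists_sq_ne : ∃ u : L, u ^ 2 ≠ (conj K L u) ^ 2 := by
  obtain ⟨v, hv, h⟩ := exists_conj_eq_neg K L
  have h2 := two_ne_zero_top K L
  refine ⟨1 + v, fun hh => ?_⟩
  rw [map_add, map_one, h] at hh
  have : (2 * 2) * v = 0 := by linear_combination hh
  exact mul_ne_zero (mul_ne_zero h2 h2) hv this

end Conjugation

section Norm

/-- The conjugate algebra `ᶥA` of an `L`-algebra `A`: the same ring, on which a scalar `l : L`
acts as `conj K L l` acts on `A`. -/
def ConjAlg (_K _L A : Type u) : Type u := A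

instance (K L A : Type u) [Ring A] : Ring (ConjAlg K L A) := inferInstanceAs (Ring A)

variable (K L : Type u) [Field K] [Field L] [Algebra K L] [NeZero (2 : K)]
  [Algebra.IsQuadraticExtension K L]

noncomputable instance (A : Type u) [Ring A] [Algebra L A] : Algebra L (ConjAlg K L A) :=
  Algebra.compHom A (conj K L : L →+* L)

/-- The `L`-algebra `ᶥA ⊗[L] A`. -/
def NormTensor (A : Type u) [Ring A] [Algebra L A] : Type u := ConjAlg K L A ⊗[L] A

variable (A : Type u) [Ring A] [Algebra L A]

noncomputable instance : Ring (NormTensor K L A) := inferInstanceAs (Ring (ConjAlg K L A ⊗[L] A))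

noncomputable instance : Algebra L (NormTensor K L A) :=
  inferInstanceAs (Algebra L (ConjAlg K L A ⊗[L] A))

noncomputable instance : Algebra K (NormTensor K L A) :=
  Algebra.compHom (NormTensor K L A) (algebraMap K L)

instance : IsScalarTower K L (NormTensor K L A) := IsScalarTower.of_algebraMap_eq fun _ => rfl

/-- The pure tensor `a ⊗ b` in `ᶥA ⊗[L] A`. -/
noncomputable def ntmul {A : Type u} [Ring A] [Algebra L A] (a b : A) : NormTensor K L A :=
  (show ConjAlg K L A from a) ⊗ₜ[L] b

variable {A}

theorem ntmul_mul_ntmul (a b a' b' : A) :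
    ntmul K L a b * ntmul K L a' b' = ntmul K L (a * a') (b * b') :=
  Algebra.TensorProduct.tmul_mul_tmul (R := L) (A := ConjAlg K L A) (B := A) a a' b b'

theorem ntmul_one_one : ntmul K L (1 : A) 1 = 1 := rfl

theorem algebraMap_normTensor (l : L) :
    algebraMap L (NormTensor K L A) l = ntmul K L 1 (algebraMap L A l) :=
  Algebra.TensorProduct.algebraMap_apply' (R := L) (A := ConjAlg K L A) (B := A) l

theorem algebraMap_normTensor' (l : L) :
    algebraMap L (NormTensor K L A) l = ntmul K L (algebraMap L A (conj K L l)) 1 := by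
  change algebraMap L (ConjAlg K L A ⊗[L] A) l =
    (algebraMap L (ConjAlg K L A) l : ConjAlg K L A) ⊗ₜ[L] (1 : A)
  rfl

@[elab_as_elim]
theorem NormTensor.induction {p : NormTensor K L A → Prop} (t : NormTensor K L A)
    (h0 : p 0) (h1 : ∀ a b : A, p (ntmul K L a b)) (h2 : ∀ x y, p x → p y → p (x + y)) : p t :=
  TensorProduct.induction_on (R := L) (M := ConjAlg K L A) (N := A) t h0 h1 h2

variable (A)

/-- The additive map underlying `switch`. -/
noncomputable def switchAdd : NormTensor K L A →+ NormTensor K L A :=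
  TensorProduct.liftAddHom (R := L) (M := ConjAlg K L A) (N := A) (P := NormTensor K L A)
    { toFun := fun a =>
        { toFun := fun b => ntmul K L b a
          map_zero' := TensorProduct.zero_tmul (R := L) _ _
          map_add' := fun x y =>
            TensorProduct.add_tmul (R := L) (M := ConjAlg K L A) (N := A) x y a }
      map_zero' := AddMonoidHom.ext fun b => TensorProduct.tmul_zero (R := L) _ _
      map_add' := fun x y => AddMonoidHom.ext fun b =>
        TensorProduct.tmul_add (R := L) (M := ConjAlg K L A) (N := A) b x y }
    (fun l a b => by
      change (show ConjAlg K L A from b) ⊗ₜ[L] (conj K L l • (show A from a)) =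
        (show ConjAlg K L A from l • b) ⊗ₜ[L] (show A from a)
      rw [← TensorProduct.smul_tmul]
      congr 1
      change conj K L (conj K L l) • b = l • b
      rw [conj_conj])

theorem switchAdd_ntmul (a b : A) : switchAdd K L A (ntmul K L a b) = ntmul K L b a := rfl

/-- The switch map `a ⊗ b ↦ b ⊗ a` of `ᶥA ⊗[L] A`; it is `conj`-semilinear over `L`. -/
noncomputable def switch : NormTensor K L A →ₐ[K] NormTensor K L A where
  __ := switchAdd K L A
  map_one' := switchAdd_ntmul K L A 1 1
  map_mul' x y := by
    change switchAdd K L A _ = switchAdd K L A x * switchAdd K L A y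
    induction x using NormTensor.induction with
    | h0 => simp
    | h2 x x' hx hx' => rw [add_mul, map_add, map_add, hx, hx', add_mul]
    | h1 a b =>
      induction y using NormTensor.induction with
      | h0 => simp
      | h2 x x' hx hx' => rw [mul_add, map_add, map_add, hx, hx', mul_add]
      | h1 a' b' => simp only [ntmul_mul_ntmul, switchAdd_ntmul]
  commutes' k := by
    change switchAdd K L A (algebraMap L _ (algebraMap K L k)) = algebraMap L _ (algebraMap K L k)
    rw [algebraMap_normTensor, switchAdd_ntmul, ← algebraMap_normTensor,
      algebraMap_normTensor' K L (algebraMap K L k), AlgEquiv.commutes]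

/-- The norm algebra (also called corestriction) of an `L`-algebra `A` for the quadratic extension
`L/K`: the `K`-subalgebra of `ᶥA ⊗[L] A` fixed by the switch map. For central simple `A` it is the
Galois descent of `ᶥA ⊗[L] A` to `K`, a central simple `K`-algebra. -/
noncomputable def normAlg : Subalgebra K (NormTensor K L A) :=
  AlgHom.equalizer (switch K L A) (AlgHom.id K _)

variable {A}

theorem switch_ntmul (a b : A) : switch K L A (ntmul K L a b) = ntmul K L b a := rfl

theorem switch_algebraMap (l : L) : switch K L A (algebraMap L _ l) =
    algebraMap L _ (conj K L l) := by
  rw [algebraMap_normTensor, switch_ntmul, algebraMap_normTensor', conj_conj]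

theorem switch_switch (t : NormTensor K L A) : switch K L A (switch K L A t) = t := by
  induction t using NormTensor.induction with
  | h0 => simp
  | h1 a b => rfl
  | h2 x y hx hy => rw [map_add, map_add, hx, hy]

theorem mem_normAlg (t : NormTensor K L A) : t ∈ normAlg K L A ↔ switch K L A t = t := Iff.rfl

theorem decomp (v : L) (hv0 : v ≠ 0) (hv : conj K L v = -v) (t : NormTensor K L A) :
    ∃ x ∈ normAlg K L A, ∃ y ∈ normAlg K L A, t = x + algebraMap L _ v * y := by
  have h2 := two_ne_zero_top K L
  refine ⟨algebraMap L _ 2⁻¹ * (t + switch K L A t), ?_,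
    algebraMap L _ (2⁻¹ * v⁻¹) * (t - switch K L A t), ?_, ?_⟩
  · rw [mem_normAlg, map_mul, switch_algebraMap, map_add, switch_switch, add_comm,
      map_inv₀, map_ofNat]
  · rw [mem_normAlg, map_mul, switch_algebraMap, map_sub, switch_switch]
    simp only [map_mul, map_inv₀, hv, map_ofNat, inv_neg, map_neg]
    noncomm_ring
  · rw [← mul_assoc, ← map_mul, show v * (2⁻¹ * v⁻¹) = 2⁻¹ by field_simp, ← mul_add,
      show t + switch K L A t + (t - switch K L A t) = 2 * t by noncomm_ring, ← mul_assoc,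
      ← map_ofNat (algebraMap L (NormTensor K L A)) 2, ← map_mul, inv_mul_cancel₀ h2, map_one,
      one_mul]

section CSA

variable [Algebra.IsCentral L A] [IsSimpleRing A]

instance : Algebra.IsCentral L (ConjAlg K L A) where
  out z hz := by
    obtain ⟨l, hl⟩ := (Algebra.IsCentral.mem_center_iff L (D := A) (x := z)).1
      (Subalgebra.mem_center_iff.2 fun b => Subalgebra.mem_center_iff.1 hz b)
    refine ⟨conj K L l, ?_⟩
    change algebraMap L A (conj K L (conj K L l)) = z
    rw [conj_conj, hl]

instance : IsSimpleRing (ConjAlg K L A) := inferInstanceAs (IsSimpleRing A)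

instance : Algebra.IsCentral L (NormTensor K L A) :=
  isCentral_tensor (K := L) (A := ConjAlg K L A) (B := A)

instance : IsSimpleRing (NormTensor K L A) :=
  isSimpleRing_tensor (K := L) (A := ConjAlg K L A) (B := A)

instance : Algebra.IsCentral K (normAlg K L A) where
  out z hz := by
    rw [Subalgebra.mem_center_iff] at hz
    obtain ⟨v, hv0, hv⟩ := exists_conj_eq_neg K L
    have hz' : (z : NormTensor K L A) ∈ Subalgebra.center L (NormTensor K L A) := by
      rw [Subalgebra.mem_center_iff]
      intro t
      obtain ⟨x, hx, y, hy, rfl⟩ := decomp K L v hv0 hv t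
      have h1 : x * z.1 = z.1 * x := congrArg Subtype.val (hz ⟨x, hx⟩)
      have h2 : y * z.1 = z.1 * y := congrArg Subtype.val (hz ⟨y, hy⟩)
      rw [add_mul, mul_add, h1, mul_assoc, h2, ← mul_assoc, Algebra.commutes, mul_assoc]
    obtain ⟨l, hl⟩ := (Algebra.IsCentral.mem_center_iff L).1 hz'
    have hfix := (mem_normAlg K L _).1 z.2
    rw [hl, switch_algebraMap] at hfix
    obtain ⟨k, rfl⟩ := mem_range_of_conj_eq K L l
      ((algebraMap L (NormTensor K L A)).injective hfix)
    exact ⟨k, Subtype.ext hl.symm⟩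

instance : IsSimpleRing (normAlg K L A) := by
  refine .of_eq_bot_or_eq_top fun I => ?_
  obtain ⟨v, hv0, hv⟩ := exists_conj_eq_neg K L
  rw [or_iff_not_imp_left]
  intro hI
  obtain ⟨w, hw, hw0 : w ≠ 0⟩ := SetLike.exists_of_lt (bot_lt_iff_ne_bot.mpr hI : ⊥ < I)
  set V := algebraMap L (NormTensor K L A) v with hV
  have hVc : ∀ t, V * t = t * V := fun t => Algebra.commutes _ _
  have hvv : conj K L (v * v) = v * v := by rw [map_mul, hv]; ring
  have hVV : V * V ∈ normAlg K L A := by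
    rw [mem_normAlg, hV, ← map_mul, switch_algebraMap, hvv]
  obtain ⟨D, hD⟩ : ∃ D : normAlg K L A, (D : NormTensor K L A) = V * V := ⟨⟨V * V, hVV⟩, rfl⟩
  let J : TwoSidedIdeal (NormTensor K L A) := TwoSidedIdeal.mk'
    {t | ∃ x ∈ I, ∃ y ∈ I, t = (x : NormTensor K L A) + V * y}
    ⟨0, I.zero_mem, 0, I.zero_mem, by simp⟩
    (by
      rintro _ _ ⟨x, hx, y, hy, rfl⟩ ⟨x', hx', y', hy', rfl⟩
      refine ⟨x + x', I.add_mem hx hx', y + y', I.add_mem hy hy', ?_⟩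
      push_cast
      noncomm_ring)
    (by
      rintro _ ⟨x, hx, y, hy, rfl⟩
      refine ⟨-x, I.neg_mem hx, -y, I.neg_mem hy, ?_⟩
      push_cast
      noncomm_ring)
    (by
      rintro t _ ⟨x, hx, y, hy, rfl⟩
      obtain ⟨a, ha, b, hb, rfl⟩ := decomp K L v hv0 hv t
      refine ⟨⟨a, ha⟩ * x + D * (⟨b, hb⟩ * y),
        I.add_mem (I.mul_mem_left _ _ hx) (I.mul_mem_left _ _ (I.mul_mem_left _ _ hy)),
        ⟨a, ha⟩ * y + ⟨b, hb⟩ * x,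
        I.add_mem (I.mul_mem_left _ _ hy) (I.mul_mem_left _ _ hx), ?_⟩
      push_cast
      rw [hD]
      have e1 : a * (V * (y : NormTensor K L A)) = V * (a * y) := by
        rw [← mul_assoc, ← hVc, mul_assoc]
      have e2 : V * b * (V * (y : NormTensor K L A)) = V * V * (b * y) := by
        rw [mul_assoc, ← mul_assoc b, ← hVc b]; noncomm_ring
      rw [← hV, add_mul, mul_add, mul_add, e1, e2]
      noncomm_ring)
    (by
      rintro _ t ⟨x, hx, y, hy, rfl⟩
      obtain ⟨a, ha, b, hb, rfl⟩ := decomp K L v hv0 hv t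
      refine ⟨x * ⟨a, ha⟩ + D * (y * ⟨b, hb⟩),
        I.add_mem (I.mul_mem_right _ _ hx) (I.mul_mem_left _ _ (I.mul_mem_right _ _ hy)),
        y * ⟨a, ha⟩ + x * ⟨b, hb⟩,
        I.add_mem (I.mul_mem_right _ _ hy) (I.mul_mem_right _ _ hx), ?_⟩
      push_cast
      rw [hD]
      have e1 : (x : NormTensor K L A) * (V * b) = V * (x * b) := by
        rw [← mul_assoc, ← hVc, mul_assoc]
      have e2 : V * (y : NormTensor K L A) * (V * b) = V * V * (y * b) := by
        rw [mul_assoc, ← mul_assoc (y : NormTensor K L A), ← hVc y]; noncomm_ring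
      rw [← hV, add_mul, mul_add, mul_add, e1, e2]
      noncomm_ring)
  have hJ : (1 : NormTensor K L A) ∈ J := by
    refine IsSimpleRing.one_mem_of_ne_zero_mem J (x := (w : NormTensor K L A))
      (fun h => hw0 (Subtype.ext h)) ?_
    exact (TwoSidedIdeal.mem_mk' _ _ _ _ _ _ _).2 ⟨w, hw, 0, I.zero_mem, by simp⟩
  obtain ⟨x, hx, y, hy, h1⟩ := (TwoSidedIdeal.mem_mk' _ _ _ _ _ _ _).1 hJ
  have h1s := congrArg (switch K L A) h1
  rw [map_one, map_add, map_mul, (mem_normAlg K L _).1 x.2, (mem_normAlg K L _).1 y.2, hV,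
    switch_algebraMap, hv, map_neg, ← hV] at h1s
  rw [← TwoSidedIdeal.one_mem_iff]
  have h2 : (1 : normAlg K L A) = ((2⁻¹ : K) • (1 : normAlg K L A)) * (x + x) := by
    have h3 : (2 : NormTensor K L A) = (x : NormTensor K L A) + x := by
      have := congrArg₂ (· + ·) h1 h1s
      rw [← one_add_one_eq_two]
      refine this.trans ?_
      noncomm_ring
    apply Subtype.ext
    push_cast
    rw [← h3, smul_mul_assoc, one_mul, ← one_add_one_eq_two (R := NormTensor K L A),
      ← two_smul K (1 : NormTensor K L A), smul_smul, inv_mul_cancel₀ (NeZero.ne (2 : K)), one_smul]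
  rw [h2]
  exact I.mul_mem_left _ _ (I.add_mem hx hx)

end CSA

instance [FiniteDimensional L A] : FiniteDimensional L (ConjAlg K L A) := by
  have : RingHomSurjective (conj K L : L →+* L) := ⟨(conj K L).surjective⟩
  let f : A →ₛₗ[(conj K L : L →+* L)] ConjAlg K L A :=
    { toFun := fun a => a
      map_add' := fun _ _ => rfl
      map_smul' := fun l a => by
        change l • a = conj K L (conj K L l) • a
        rw [conj_conj] }
  exact Module.Finite.of_surjective f fun a => ⟨a, rfl⟩

instance [FiniteDimensional L A] : FiniteDimensional L (NormTensor K L A) :=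
  inferInstanceAs (Module.Finite L (ConjAlg K L A ⊗[L] A))

instance [FiniteDimensional L A] : FiniteDimensional K (NormTensor K L A) :=
  Module.Finite.trans L (NormTensor K L A)

instance [FiniteDimensional L A] : FiniteDimensional K (normAlg K L A) :=
  inferInstanceAs (FiniteDimensional K (Subalgebra.toSubmodule (normAlg K L A)))

section Functoriality

variable {B : Type u} [Ring B] [Algebra L B]

/-- Conjugation of algebras is functorial for isomorphisms. -/
noncomputable def conjCongr (e : A ≃ₐ[L] B) : ConjAlg K L A ≃ₐ[L] ConjAlg K L B where
  toFun := e
  invFun := e.symm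
  left_inv := e.left_inv
  right_inv := e.right_inv
  map_mul' := e.map_mul'
  map_add' := e.map_add'
  commutes' l := e.commutes (conj K L l)

/-- Functoriality of `NormTensor` for isomorphisms. -/
noncomputable def normTensorCongr (e : A ≃ₐ[L] B) : NormTensor K L A ≃ₐ[L] NormTensor K L B :=
  (Algebra.TensorProduct.congr (conjCongr K L e) e :
    ConjAlg K L A ⊗[L] A ≃ₐ[L] ConjAlg K L B ⊗[L] B)

theorem normTensorCongr_ntmul (e : A ≃ₐ[L] B) (a b : A) :
    normTensorCongr K L e (ntmul K L a b) = ntmul K L (e a) (e b) := rfl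

/-- Functoriality of `normAlg` for isomorphisms. -/
noncomputable def normAlgCongr (e : A ≃ₐ[L] B) : normAlg K L A ≃ₐ[K] normAlg K L B :=
  fixedEquiv (switch K L A) (switch K L B) ((normTensorCongr K L e).restrictScalars K) (fun t => by
    change normTensorCongr K L e _ = switch K L B (normTensorCongr K L e t)
    induction t using NormTensor.induction with
    | h0 => simp
    | h1 a b => rfl
    | h2 x y hx hy => simp only [map_add, hx, hy])

end Functoriality

section Matrices

variable (A) (n : Type) [Fintype n] [DecidableEq n]

/-- The conjugate of a matrix algebra is a matrix algebra over the conjugate. -/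
noncomputable def conjMatrix : ConjAlg K L (Matrix n n A) ≃ₐ[L] Matrix n n (ConjAlg K L A) where
  toFun M := M
  invFun M := M
  left_inv _ := rfl
  right_inv _ := rfl
  map_mul' _ _ := rfl
  map_add' _ _ := rfl
  commutes' _ := rfl

/-- `NormTensor` of a matrix algebra, as a matrix algebra. -/
noncomputable def normTensorMatrix :
    NormTensor K L (Matrix n n A) ≃ₐ[L] Matrix (n × n) (n × n) (NormTensor K L A) :=
  (Algebra.TensorProduct.congr (conjMatrix K L A n) (AlgEquiv.refl (A₁ := Matrix n n A))).trans
    (Matrix.kroneckerTMulAlgEquiv n n L L (ConjAlg K L A) A)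

theorem normTensorMatrix_ntmul (X Y : Matrix n n A) (i j : n × n) :
    normTensorMatrix K L A n (ntmul K L X Y) i j = ntmul K L (X i.1 j.1) (Y i.2 j.2) := rfl

/-- The switch map of a matrix algebra, transported along `normTensorMatrix`. -/
noncomputable def twistedSwitch :
    Matrix (n × n) (n × n) (NormTensor K L A) →ₐ[K] Matrix (n × n) (n × n) (NormTensor K L A) :=
  (Matrix.reindexAlgEquiv K (NormTensor K L A) (Equiv.prodComm n n)).toAlgHom.comp
    (switch K L A).mapMatrix

theorem nonempty_normAlg_matrix :
    Nonempty (normAlg K L (Matrix n n A) ≃ₐ[K] Matrix (n × n) (n × n) (normAlg K L A)) := by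
  let e1 : normAlg K L (Matrix n n A) ≃ₐ[K]
      AlgHom.equalizer (twistedSwitch K L A n) (AlgHom.id K _) :=
    fixedEquiv (switch K L (Matrix n n A)) (twistedSwitch K L A n)
      ((normTensorMatrix K L A n).restrictScalars K) (fun t => by
        change normTensorMatrix K L A n _ = twistedSwitch K L A n (normTensorMatrix K L A n t)
        induction t using NormTensor.induction with
        | h0 => simp
        | h1 a b => rfl
        | h2 x y hx hy => simp only [map_add, hx, hy])
  let e3 := fixedMatrix (m := n × n) (switch K L A)
  obtain ⟨u, hu⟩ := exists_sq_ne K L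
  let W : Matrix (n × n) (n × n) (NormTensor K L A) :=
    (1 : Matrix (n × n) (n × n) (NormTensor K L A)).submatrix Prod.swap id
  have hWM : ∀ M : Matrix (n × n) (n × n) (NormTensor K L A), W * M = M.submatrix Prod.swap id := by
    intro M
    change ((1 : Matrix (n × n) (n × n) (NormTensor K L A)).submatrix Prod.swap id) * M = _
    rw [← Matrix.submatrix_id_id M, ← Matrix.submatrix_mul _ _ _ id _ Function.bijective_id,
      Matrix.one_mul]
    rfl
  have hMW : ∀ M : Matrix (n × n) (n × n) (NormTensor K L A), M * W = M.submatrix id Prod.swap := by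
    intro M
    have : W = (1 : Matrix (n × n) (n × n) (NormTensor K L A)).submatrix id Prod.swap := by
      ext i j
      simp [W, Matrix.one_apply, Prod.ext_iff, and_comm]
    rw [this]
    rw [← Matrix.submatrix_id_id M, ← Matrix.submatrix_mul _ _ _ id _ Function.bijective_id,
      Matrix.mul_one]
    rfl
  obtain ⟨e2⟩ := fixed_twist (K := K) (L := L) (conj K L : L →+* L)
    ((switch K L A).mapMatrix (m := n × n)) (twistedSwitch K L A n)
    (fun l => by
      ext i j
      change switch K L A (algebraMap L (Matrix (n × n) (n × n) (NormTensor K L A)) l i j) = _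
      rw [Matrix.algebraMap_matrix_apply, Matrix.algebraMap_matrix_apply]
      split_ifs
      · exact switch_algebraMap K L l
      · simp)
    W
    (by
      rw [hWM]
      ext i j
      simp [W, Matrix.one_apply])
    (by
      ext i j
      change switch K L A (W i j) = W i j
      simp only [W, Matrix.submatrix_apply, Matrix.one_apply]
      split_ifs <;> simp)
    (fun x => by
      rw [hWM, hMW]
      rfl)
    (conj_conj K L) u hu
  exact ⟨e1.trans (e2.symm.trans e3)⟩

end Matrices

end Norm

section Brauer

/-- The central simple `K`-algebra given by unbundled data. -/
def csaOf (K : Type u) [Field K] (A : Type u) [Ring A] [Algebra K A] [Algebra.IsCentral K A]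
    [IsSimpleRing A] [FiniteDimensional K A] : CSA.{u, u} K where
  __ := AlgCat.of K A

/-- The Brauer class of a central simple `K`-algebra. -/
def brauerClass (K : Type u) [Field K] (A : Type u) [Ring A] [Algebra K A] [Algebra.IsCentral K A]
    [IsSimpleRing A] [FiniteDimensional K A] : BrauerGroup.{u, u} K :=
  Quotient.mk _ (csaOf K A)

/-- The neutral element of the (additively written) Brauer group: the class of `K`. -/
instance (K : Type u) [Field K] : Zero (BrauerGroup.{u, u} K) := ⟨brauerClass K K⟩

variable (K L : Type u) [Field K] [Field L] [Algebra K L]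

instance (A : Type u) [Ring A] [Algebra K A] [Algebra.IsCentral K A] :
    Algebra.IsCentral L (L ⊗[K] A) := isCentral_baseChange L

instance (A : Type u) [Ring A] [Algebra K A] [Algebra.IsCentral K A] [IsSimpleRing A] :
    IsSimpleRing (L ⊗[K] A) :=
  .of_ringEquiv (Algebra.TensorProduct.comm K A L).toRingEquiv isSimpleRing_tensor

/-- Base change of a matrix algebra. -/
noncomputable def baseChangeMatrix (A : Type u) [Ring A] [Algebra K A] (n : ℕ) :
    L ⊗[K] Matrix (Fin n) (Fin n) A ≃ₐ[L] Matrix (Fin n) (Fin n) (L ⊗[K] A) :=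
  ((Algebra.TensorProduct.congr (Matrix.uniqueAlgEquiv (m := Unit) (R := L) (A := L)).symm
    (AlgEquiv.refl (A₁ := Matrix (Fin n) (Fin n) A))).trans
      (Matrix.kroneckerTMulAlgEquiv Unit (Fin n) K L L A)).trans
        (Matrix.reindexAlgEquiv L _ (Equiv.punitProd (Fin n)))

/-- The restriction map `Br(K) → Br(L)`, `[A] ↦ [L ⊗[K] A]`. -/
noncomputable def res : BrauerGroup.{u, u} K → BrauerGroup.{u, u} L :=
  Quotient.map (sa := Brauer.CSA_Setoid K) (sb := Brauer.CSA_Setoid L)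
    (fun A => csaOf L (L ⊗[K] A)) (by
      rintro A B ⟨n, m, hn, hm, ⟨e⟩⟩
      exact ⟨n, m, hn, hm, ⟨(baseChangeMatrix K L A n).symm.trans
        ((Algebra.TensorProduct.congr AlgEquiv.refl e).trans (baseChangeMatrix K L B m))⟩⟩)

/-- The corestriction map `Br(L) → Br(K)` of a quadratic extension `L/K` in characteristic
different from `2`, sending the class of a central simple `L`-algebra to the class of its norm
algebra. -/
noncomputable def cores [NeZero (2 : K)] [Algebra.IsQuadraticExtension K L] :
    BrauerGroup.{u, u} L → BrauerGroup.{u, u} K :=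
  Quotient.map (sa := Brauer.CSA_Setoid L) (sb := Brauer.CSA_Setoid K)
    (fun A => csaOf K (normAlg K L A)) (by
      rintro A B ⟨n, m, hn, hm, ⟨e⟩⟩
      obtain ⟨eA⟩ := nonempty_normAlg_matrix K L A (Fin n)
      obtain ⟨eB⟩ := nonempty_normAlg_matrix K L B (Fin m)
      exact ⟨n * n, m * m, mul_ne_zero hn hn, mul_ne_zero hm hm,
        ⟨(Matrix.reindexAlgEquiv K _ finProdFinEquiv).symm.trans
          (eA.symm.trans ((normAlgCongr K L e).trans
            (eB.trans (Matrix.reindexAlgEquiv K _ finProdFinEquiv))))⟩⟩)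

/-- `A` is a quaternion algebra over `K` (of characteristic different from `2`): it has a basis
`1, i, j, ij` with `i² = a`, `j² = b`, `ij = -ji` for some nonzero `a`, `b` in `K`. -/
def IsQuaternionAlgebra (K : Type u) [Field K] (A : Type u) [Ring A] [Algebra K A] : Prop :=
  ∃ a b : K, a ≠ 0 ∧ b ≠ 0 ∧ Nonempty (A ≃ₐ[K] QuaternionAlgebra K a 0 b)

/-- `α` is the Brauer class of a quaternion algebra over `K`. -/
def IsQuaternionClass (K : Type u) [Field K] (α : BrauerGroup.{u, u} K) : Prop :=
  ∃ A : CSA.{u, u} K, IsQuaternionAlgebra K A ∧ Quotient.mk (Brauer.CSA_Setoid K) A = α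

end Brauer
end BrauerCores

/-! The bridge between the two conditions is a unitary involution: an involutive antiautomorphism τ
of the `L`-algebra A that restricts to the conjugation of `L/K`.

Such a τ makes A a module over `ᶥA ⊗ A` by (x ⊗ y) z = y z τ(x). Elements fixed by the switch
commute with τ, so the norm algebra acts on the `K`-space of τ-fixed points. That space has
`K`-dimension d = dim_L A, and the norm algebra is simple of dimension d², so the action identifies
it with d × d matrices over `K` (`IsUnitaryInvolution.nonempty_normAlg`). For an algebra restricted
from a quaternion algebra over `K`, quaternion conjugation composed with conjugation of the
coefficients is unitary, so its corestriction vanishes.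

Conversely, let A be a division algebra whose norm algebra is split, and let ε be a rank-one
idempotent of the norm algebra. The left ideal of `ᶥA ⊗ A` generated by ε has `L`-dimension d, and b
↦ (1 ⊗ b) ε maps A bijectively onto it. The equation (a ⊗ 1) ε = (1 ⊗ τ a) ε then defines a unitary
involution τ (`exists_isUnitaryInvolution`). On a quaternion algebra, τ preserves pure quaternions,
and this yields anticommuting pure generators with τ i = -i and τ j = -j; their squares are scalars
fixed by conjugation, hence in `K` (`IsUnitaryInvolution.exists_descent`). A quaternion algebra that
is not division is the matrix algebra, which is (1, 1) and already comes from `K`. -/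

namespace BrauerCores

/-! ### Isomorphisms from dimension counts -/

section Dimension

/-- A homomorphism from a simple algebra to a nonzero algebra of the same finite dimension is an
isomorphism. -/
noncomputable def algEquivOfFinrankEq {F A B : Type*} [Field F] [Ring A] [Algebra F A] [Ring B]
    [Algebra F B] [IsSimpleRing A] [Nontrivial B] [FiniteDimensional F A] [FiniteDimensional F B]
    (f : A →ₐ[F] B) (h : Module.finrank F A = Module.finrank F B) : A ≃ₐ[F] B :=
  AlgEquiv.ofBijective f <| by
    have hf : Function.Injective f := RingHom.injective (f : A →+* B)
    exact ⟨hf, (LinearMap.injective_iff_surjective_of_finrank_eq_finrank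
      (f := f.toLinearMap) h).1 hf⟩

/-- A central simple algebra of dimension `4` with a nonzero nonunit is the algebra of `2 × 2`
matrices. -/
theorem nonempty_algEquiv_matrix_two {F A : Type u} [Field F] [Ring A] [Algebra F A]
    [IsSimpleRing A] [FiniteDimensional F A] (h4 : Module.finrank F A = 4)
    (x : A) (hx0 : x ≠ 0) (hx : ¬ IsUnit x) :
    Nonempty (A ≃ₐ[F] Matrix (Fin 2) (Fin 2) F) := by
  have : IsArtinianRing A := .of_finite F A
  obtain ⟨n, hn, D, _, _, _, ⟨e⟩⟩ :=
    IsSimpleRing.exists_algEquiv_matrix_divisionRing_finite F A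
  have hdim := e.toLinearEquiv.finrank_eq
  rw [h4, Module.finrank_matrix, Fintype.card_fin] at hdim
  have hn0 : n ≠ 0 := NeZero.ne n
  have hD : 0 < Module.finrank F D := Module.finrank_pos
  -- Wedderburn gives A = M_n(D) with n² [D : F] = 4. If n = 1, then A is a division algebra and `x`
  -- would be a unit; n = 2 forces D = F.
  have hn2 : n ≤ 2 := by nlinarith
  obtain rfl | rfl : n = 1 ∨ n = 2 := by omega
  · refine absurd ?_ hx
    have e₁ : Matrix (Fin 1) (Fin 1) D ≃ₐ[F] D := by
      convert Matrix.uniqueAlgEquiv (m := Fin 1) (R := F) (A := D)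
    let e' := e.trans e₁
    have : e' x ≠ 0 := by simpa using hx0
    simpa using (this.isUnit).map e'.symm
  · have hD1 : Module.finrank F D = 1 := by omega
    have : Function.Bijective (algebraMap F D) :=
      bijective_algebraMap_of_linearEquiv
        (LinearEquiv.ofFinrankEq F D (by rw [hD1, Module.finrank_self]))
    exact ⟨e.trans (AlgEquiv.ofBijective (Algebra.ofId F D) this).symm.mapMatrix⟩

end Dimension

/-! ### Quaternion algebras over a field -/

section Quaternion

variable {F : Type u} [Field F]

/-- A quaternion is a root of X² - 2 re X + N, so a pure one squares to the scalar -N. -/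
theorem sq_eq_of_re_eq_zero {a b : F} (x : QuaternionAlgebra F a 0 b) (h : x.re = 0) :
    ∃ l : F, x * x = algebraMap F _ l := by
  refine ⟨a * x.imI * x.imI + b * x.imJ * x.imJ - a * b * x.imK * x.imK, ?_⟩
  rw [QuaternionAlgebra.algebraMap_eq]
  ext <;> simp [h] <;> ring

/-- Commuting with i kills the j and ij coordinates, and commuting with j kills the i coordinate. -/
theorem isCentral_quaternion [NeZero (2 : F)] {a b : F} (ha : a ≠ 0) :
    Algebra.IsCentral F (QuaternionAlgebra F a 0 b) where
  out z hz := by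
    have h2 := NeZero.ne (2 : F)
    rw [Subalgebra.mem_center_iff] at hz
    have hi := hz ⟨0, 1, 0, 0⟩
    have hj := hz ⟨0, 0, 1, 0⟩
    simp only [QuaternionAlgebra.ext_iff, QuaternionAlgebra.re_mul, QuaternionAlgebra.imI_mul,
      QuaternionAlgebra.imJ_mul, QuaternionAlgebra.imK_mul] at hi hj
    obtain ⟨-, -, h1, h3⟩ := hi
    obtain ⟨-, -, -, h5⟩ := hj
    have e1 : (2 * a) * z.imK = 0 := by linear_combination h1
    have e2 : 2 * z.imJ = 0 := by linear_combination h3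
    have e3 : 2 * z.imI = 0 := by linear_combination -h5
    have e1' : z.imK = 0 := by simpa [h2, ha] using e1
    have e2' : z.imJ = 0 := by simpa [h2] using e2
    have e3' : z.imI = 0 := by simpa [h2] using e3
    refine ⟨z.re, ?_⟩
    change algebraMap F _ z.re = z
    rw [QuaternionAlgebra.algebraMap_eq]
    ext <;> simp [e1', e2', e3']

/-- The map y ↦ a y + i y i keeps only the coordinates on 1 and i, scaled by 2a, and y ↦ b y + j y j
keeps only those on 1 and j, scaled by 2b. These maps preserve ideals, so they isolate a nonzero
coordinate of a nonzero element; multiplying by a suitable element then gives a nonzero scalar. -/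
theorem isSimpleRing_quaternion [NeZero (2 : F)] {a b : F} (ha : a ≠ 0) (hb : b ≠ 0) :
    IsSimpleRing (QuaternionAlgebra F a 0 b) := by
  have h2 := NeZero.ne (2 : F)
  refine .of_eq_bot_or_eq_top fun I => ?_
  rw [or_iff_not_imp_left]
  intro hI
  obtain ⟨x, hx, hx0 : x ≠ 0⟩ := SetLike.exists_of_lt (bot_lt_iff_ne_bot.mpr hI : ⊥ < I)
  rw [← TwoSidedIdeal.one_mem_iff]
  have key : ∀ (r : F) (y z : QuaternionAlgebra F a 0 b), r ≠ 0 → y ∈ I →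
      z * y = algebraMap F _ r → 1 ∈ I := by
    intro r y z hr hy h
    have : (algebraMap F (QuaternionAlgebra F a 0 b) r⁻¹ * z) * y = 1 := by
      rw [mul_assoc, h, ← map_mul, inv_mul_cancel₀ hr, map_one]
    exact this ▸ I.mul_mem_left _ _ hy
  let i : QuaternionAlgebra F a 0 b := ⟨0, 1, 0, 0⟩
  let j : QuaternionAlgebra F a 0 b := ⟨0, 0, 1, 0⟩
  have hp : ∀ y ∈ I, (a • y + i * y * i) ∈ I ∧ (a • y - i * y * i) ∈ I ∧
      (b • y + j * y * j) ∈ I ∧ (b • y - j * y * j) ∈ I := by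
    intro y hy
    have hs : ∀ c : F, c • y ∈ I := fun c => by
      rw [Algebra.smul_def]
      exact I.mul_mem_left _ _ hy
    have h1 := I.mul_mem_right _ i (I.mul_mem_left i _ hy)
    have h3 := I.mul_mem_right _ j (I.mul_mem_left j _ hy)
    exact ⟨I.add_mem (hs a) h1, I.sub_mem (hs a) h1, I.add_mem (hs b) h3, I.sub_mem (hs b) h3⟩
  by_cases h0 : x.re = 0
  · by_cases h1 : x.imI = 0
    · by_cases h3 : x.imJ = 0
      · have h4 : x.imK ≠ 0 := fun h4 => hx0 (by ext <;> simp [h0, h1, h3, h4])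
        refine key (-(a * b * x.imK * x.imK)) x x (by simp [*]) hx ?_
        rw [QuaternionAlgebra.algebraMap_eq]
        ext <;> simp [h0, h1, h3]; try ring
      · have hy := (hp x hx).2.2.1
        refine key (2 * b * b * x.imJ) _ j (by simp [*]) hy ?_
        rw [QuaternionAlgebra.algebraMap_eq]
        ext <;> simp [h0, h1, j]; ring
    · have hy := (hp x hx).1
      refine key (2 * a * a * x.imI) _ i (by simp [*]) hy ?_
      rw [QuaternionAlgebra.algebraMap_eq]
      ext <;> simp [h0, i]; ring
  · have hy := (hp _ (hp x hx).1).2.2.1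
    refine key (4 * a * b * x.re) _ 1
      (by rw [show (4 : F) = 2 * 2 by norm_num]; simp [*]) hy ?_
    rw [QuaternionAlgebra.algebraMap_eq]
    ext <;> simp [i, j] <;> ring

/-- Anticommuting square roots of nonzero scalars in an algebra of dimension `4` make it a
quaternion algebra. -/
theorem nonempty_algEquiv_quaternion [NeZero (2 : F)] {A : Type*} [Ring A] [Nontrivial A]
    [Algebra F A] [FiniteDimensional F A] (h4 : Module.finrank F A = 4) {a b : F} (ha : a ≠ 0)
    (hb : b ≠ 0) (i j : A) (hi : i * i = algebraMap F A a) (hj : j * j = algebraMap F A b)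
    (hij : i * j = -(j * i)) : Nonempty (A ≃ₐ[F] QuaternionAlgebra F a 0 b) := by
  have := isSimpleRing_quaternion ha hb
  let q : QuaternionAlgebra.Basis A a 0 b :=
    { i := i
      j := j
      k := i * j
      i_mul_i := by rw [hi, zero_smul, add_zero, Algebra.algebraMap_eq_smul_one]
      j_mul_j := by rw [hj, Algebra.algebraMap_eq_smul_one]
      i_mul_j := rfl
      j_mul_i := by rw [hij]; simp }
  -- Simplicity of the quaternion algebra makes the lift injective, so the linear independence of 1,
  -- i, j, ij in A comes for free.
  exact ⟨(algEquivOfFinrankEq q.liftHom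
    (by rw [h4, QuaternionAlgebra.finrank_eq_four])).symm⟩

/-- When i² = 1, the elements 1 + i and 1 - i are zero divisors. -/
theorem nonempty_quaternion_one_one [NeZero (2 : F)] :
    Nonempty (QuaternionAlgebra F 1 0 1 ≃ₐ[F] Matrix (Fin 2) (Fin 2) F) := by
  have := isSimpleRing_quaternion (F := F) one_ne_zero one_ne_zero
  let x : QuaternionAlgebra F 1 0 1 := ⟨1, 1, 0, 0⟩
  let y : QuaternionAlgebra F 1 0 1 := ⟨1, -1, 0, 0⟩
  have hx : x ≠ 0 := fun h => one_ne_zero (congrArg QuaternionAlgebra.re h)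
  have hy : y ≠ 0 := fun h => one_ne_zero (congrArg QuaternionAlgebra.re h)
  have hxy : x * y = 0 := by ext <;> simp [x, y]
  refine nonempty_algEquiv_matrix_two (QuaternionAlgebra.finrank_eq_four _ _ _) x hx fun h => hy ?_
  exact (h.mul_right_eq_zero).1 hxy

theorem nonempty_baseChange_quaternion {K L : Type u} [Field K] [Field L] [Algebra K L]
    [NeZero (2 : K)] {a b : K} (ha : a ≠ 0) (hb : b ≠ 0) :
    Nonempty (L ⊗[K] QuaternionAlgebra K a 0 b ≃ₐ[L]
      QuaternionAlgebra L (algebraMap K L a) 0 (algebraMap K L b)) := by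
  have : NeZero (2 : L) := ⟨two_ne_zero_top K L⟩
  have := isSimpleRing_quaternion ha hb
  have := isCentral_quaternion (b := b) ha
  have : FiniteDimensional L (L ⊗[K] QuaternionAlgebra K a 0 b) := inferInstance
  let q := QuaternionAlgebra.Basis.self K (c₁ := a) (c₂ := 0) (c₃ := b)
  have q1 := q.i_mul_i
  rw [zero_smul, add_zero] at q1
  have q3 := q.j_mul_i
  rw [zero_smul, zero_sub, ← q.i_mul_j] at q3
  refine nonempty_algEquiv_quaternion
    (by rw [Module.finrank_baseChange, QuaternionAlgebra.finrank_eq_four])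
    ((map_ne_zero _).2 ha) ((map_ne_zero _).2 hb) (1 ⊗ₜ q.i) (1 ⊗ₜ q.j) ?_ ?_ ?_
  · rw [Algebra.TensorProduct.tmul_mul_tmul, q1, one_mul, TensorProduct.tmul_smul,
      Algebra.algebraMap_eq_smul_one, algebraMap_smul]
    rfl
  · rw [Algebra.TensorProduct.tmul_mul_tmul, q.j_mul_j, one_mul, TensorProduct.tmul_smul,
      Algebra.algebraMap_eq_smul_one, algebraMap_smul]
    rfl
  · rw [Algebra.TensorProduct.tmul_mul_tmul, Algebra.TensorProduct.tmul_mul_tmul, q3, one_mul,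
      TensorProduct.tmul_neg, neg_neg]

end Quaternion

/-! ### Unitary involutions and descent of quaternion algebras -/

section UnitaryInvolution

variable (K L : Type u) [Field K] [Field L] [Algebra K L] [NeZero (2 : K)]
  [Algebra.IsQuadraticExtension K L]

/-- A unitary involution of an `L`-algebra for the quadratic extension `L/K`: an involutive
antiautomorphism which restricts to the conjugation on `L`. -/
structure IsUnitaryInvolution {A : Type*} [Ring A] [Algebra L A] (τ : A →+ A) : Prop where
  map_mul (x y : A) : τ (x * y) = τ y * τ x
  map_algebraMap (l : L) : τ (algebraMap L A l) = algebraMap L A (conj K L l)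
  involutive (x : A) : τ (τ x) = x

variable {K L}

theorem IsUnitaryInvolution.map_smul {A : Type*} [Ring A] [Algebra L A] {τ : A →+ A}
    (h : IsUnitaryInvolution K L τ) (l : L) (x : A) : τ (l • x) = conj K L l • τ x := by
  rw [Algebra.smul_def, h.map_mul, h.map_algebraMap, Algebra.smul_def, Algebra.commutes]

variable {a b : L}

/-- A unitary involution preserves the pure quaternions. -/
theorem IsUnitaryInvolution.re_eq_zero {τ : QuaternionAlgebra L a 0 b →+ QuaternionAlgebra L a 0 b}
    (h : IsUnitaryInvolution K L τ) {x : QuaternionAlgebra L a 0 b} (hx : x.re = 0) :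
    (τ x).re = 0 := by
  have h2 := two_ne_zero_top K L
  obtain ⟨l, hl⟩ := sq_eq_of_re_eq_zero x hx
  have hsq : τ x * τ x = algebraMap L _ (conj K L l) := by
    rw [← h.map_mul, hl, h.map_algebraMap]
  -- The imaginary coordinates of a square are 2 re times those of the element. Hence if τ x has
  -- nonzero real part and scalar square, it is a scalar; then x = τ (τ x) is a scalar too, and
  -- being pure it vanishes.
  by_contra hc
  have hI := congrArg QuaternionAlgebra.imI hsq
  have hJ := congrArg QuaternionAlgebra.imJ hsq
  have hK := congrArg QuaternionAlgebra.imK hsq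
  simp only [QuaternionAlgebra.imI_mul, QuaternionAlgebra.imJ_mul, QuaternionAlgebra.imK_mul,
    QuaternionAlgebra.algebraMap_eq] at hI hJ hK
  have eI : (2 * (τ x).re) * (τ x).imI = 0 := by linear_combination hI
  have eJ : (2 * (τ x).re) * (τ x).imJ = 0 := by linear_combination hJ
  have eK : (2 * (τ x).re) * (τ x).imK = 0 := by linear_combination hK
  simp only [mul_eq_zero, h2, hc, false_or] at eI eJ eK
  have hτ : τ x = algebraMap L _ (τ x).re := by
    rw [QuaternionAlgebra.algebraMap_eq]
    ext <;> simp [eI, eJ, eK]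
  have hx' : x = algebraMap L _ (conj K L (τ x).re) := by
    rw [← h.map_algebraMap, ← hτ, h.involutive]
  have hre := congrArg QuaternionAlgebra.re hx'
  rw [hx, QuaternionAlgebra.algebraMap_eq] at hre
  exact hc ((map_eq_zero (conj K L)).1 hre.symm)

/-- A nonzero `τ`-stable subspace contains a nonzero skew-symmetric element. -/
theorem IsUnitaryInvolution.exists_skew {A : Type*} [Ring A] [Algebra L A] {τ : A →+ A}
    (h : IsUnitaryInvolution K L τ) (W : Submodule L A) (hW : ∀ x ∈ W, τ x ∈ W) {x : A}
    (hx : x ∈ W) (hx0 : x ≠ 0) : ∃ y ∈ W, y ≠ 0 ∧ τ y = -y := by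
  -- The element x - τ x is skew. If it vanishes, x is symmetric, and multiplying by a scalar v with
  -- conjugate -v makes it skew.
  by_cases hs : x - τ x = 0
  · obtain ⟨v, hv0, hv⟩ := exists_conj_eq_neg K L
    refine ⟨v • x, W.smul_mem _ hx, smul_ne_zero hv0 hx0, ?_⟩
    rw [h.map_smul, hv, ← sub_eq_zero.1 hs, neg_smul]
  · refine ⟨x - τ x, W.sub_mem hx (hW x hx), hs, ?_⟩
    rw [map_sub, h.involutive, neg_sub]

/-- Descent of a quaternion division algebra along a unitary involution. -/
theorem IsUnitaryInvolution.exists_descent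
    {τ : QuaternionAlgebra L a 0 b →+ QuaternionAlgebra L a 0 b} (h : IsUnitaryInvolution K L τ)
    (ha : a ≠ 0) (hdiv : ∀ x : QuaternionAlgebra L a 0 b, x ≠ 0 → IsUnit x) :
    ∃ c d : K, c ≠ 0 ∧ d ≠ 0 ∧ Nonempty (QuaternionAlgebra L a 0 b ≃ₐ[L]
      QuaternionAlgebra L (algebraMap K L c) 0 (algebraMap K L d)) := by
  have : NeZero (2 : L) := ⟨two_ne_zero_top K L⟩
  have := isCentral_quaternion (b := b) ha
  set A := QuaternionAlgebra L a 0 b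
  have hinj : Function.Injective (algebraMap L A) := (algebraMap L A).injective
  -- For skew x the scalar x² is fixed by τ, hence by conjugation, so it lies in `K`. It is nonzero
  -- because A is a division algebra.
  have key : ∀ x : A, x.re = 0 → x ≠ 0 → τ x = -x →
      ∃ c : K, c ≠ 0 ∧ x * x = algebraMap L A (algebraMap K L c) := by
    intro x hx hx0 hτ
    obtain ⟨l, hl⟩ := sq_eq_of_re_eq_zero x hx
    have hc : conj K L l = l := hinj (by
      rw [← h.map_algebraMap, ← hl, h.map_mul, hτ, neg_mul_neg])
    obtain ⟨c, rfl⟩ := mem_range_of_conj_eq K L l hc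
    refine ⟨c, ?_, hl⟩
    rintro rfl
    rw [map_zero, map_zero] at hl
    exact hx0 ((hdiv x hx0).mul_right_eq_zero.1 hl)
  let W₁ : Submodule L A :=
    { carrier := {x | x.re = 0}
      zero_mem' := rfl
      add_mem' := fun {x y} hx hy => by
        change x.re + y.re = 0
        rw [show x.re = 0 from hx, show y.re = 0 from hy, add_zero]
      smul_mem' := fun l x hx => by
        change l * x.re = 0
        rw [show x.re = 0 from hx, mul_zero] }
  let i₀ : A := ⟨0, 1, 0, 0⟩
  have hi₀ : i₀ ≠ 0 := fun h => one_ne_zero (congrArg QuaternionAlgebra.imI h)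
  obtain ⟨i, hi, hi0, hτi⟩ := h.exists_skew W₁ (fun x hx => h.re_eq_zero hx)
    (x := i₀) rfl hi₀
  obtain ⟨c, hc, hic⟩ := key i hi hi0 hτi
  -- The pure quaternions anticommuting with i. This space is τ-stable because τ i = -i. It contains
  -- every commutator i z - z i because i² is central, and some commutator is nonzero because a
  -- nonzero pure i is not central.
  let W₂ : Submodule L A := W₁ ⊓ LinearMap.ker (LinearMap.mulLeft L i + LinearMap.mulRight L i)
  have hmem : ∀ x, x ∈ W₂ ↔ x.re = 0 ∧ i * x + x * i = 0 := fun x => Iff.rfl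
  obtain ⟨z, hz⟩ : ∃ z, i * z - z * i ≠ 0 := by
    by_contra! hz
    obtain ⟨l, hl⟩ := (Algebra.IsCentral.mem_center_iff L (x := i)).1
      (Subalgebra.mem_center_iff.2 fun z => (sub_eq_zero.1 (hz z)).symm)
    apply hi0
    have : i.re = 0 := hi
    rw [hl, QuaternionAlgebra.algebraMap_eq] at this
    change l = 0 at this
    rw [hl, this, map_zero]
  obtain ⟨j, hj, hj0, hτj⟩ := h.exists_skew W₂ (fun x hx => by
      rw [hmem] at hx ⊢
      refine ⟨h.re_eq_zero hx.1, ?_⟩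
      have := congrArg τ hx.2
      rw [map_add, h.map_mul, h.map_mul, hτi, map_zero] at this
      rw [← neg_eq_zero, ← this]
      noncomm_ring)
    (x := i * z - z * i) ((hmem _).2 (by
      constructor
      · simp only [QuaternionAlgebra.re_sub, QuaternionAlgebra.re_mul]
        ring
      · have e : i * i * z = z * (i * i) := by rw [hic, Algebra.commutes]
        rw [show i * (i * z - z * i) + (i * z - z * i) * i = i * i * z - z * (i * i) by noncomm_ring,
          e, sub_self])) hz
  rw [hmem] at hj
  obtain ⟨d, hd, hjd⟩ := key j hj.1 hj0 hτj
  exact ⟨c, d, hc, hd, nonempty_algEquiv_quaternion (QuaternionAlgebra.finrank_eq_four _ _ _)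
    ((map_ne_zero _).2 hc) ((map_ne_zero _).2 hd) i j hic hjd (eq_neg_of_add_eq_zero_left hj.2)⟩

end UnitaryInvolution

/-! ### Dimension of the norm algebra -/

section Dimension

/-- The fixed points of a conjugate-linear involution are a `K`-form. -/
theorem finrank_eq_two_mul_fixed (K L : Type u) [Field K] [Field L] [Algebra K L] [NeZero (2 : K)]
    [Algebra.IsQuadraticExtension K L] {M : Type*} [AddCommGroup M] [Module K M] [Module L M]
    [IsScalarTower K L M] [FiniteDimensional K M] (s : M →+ M)
    (hs : ∀ (l : L) (x : M), s (l • x) = conj K L l • s x) (hinv : ∀ x, s (s x) = x)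
    (V : Submodule K M) (hV : ∀ x, x ∈ V ↔ s x = x) :
    Module.finrank K M = 2 * Module.finrank K V := by
  have h2 := two_ne_zero_top K L
  obtain ⟨v, hv0, hv⟩ := exists_conj_eq_neg K L
  -- Since conjugation negates v, the -1 eigenspace of s is v V. The map f is the decomposition of M
  -- into the two eigenspaces, with components ½ (t ± s t).
  let f : (V × V) →ₗ[K] M := V.subtype.coprod ((Algebra.lsmul K K M v).comp V.subtype)
  have hf : ∀ x y, f (x, y) = (x : M) + v • (y : M) := fun x y => rfl
  have half : ∀ x : M, x + x = 0 → x = 0 := fun x hx => by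
    rw [← two_smul L] at hx
    exact (smul_eq_zero.1 hx).resolve_left h2
  have hbij : Function.Bijective f := by
    constructor
    · rw [← LinearMap.ker_eq_bot, LinearMap.ker_eq_bot']
      rintro ⟨x, y⟩ h
      rw [hf] at h
      have h' := congrArg s h
      rw [map_add, hs, hv, (hV _).1 x.2, (hV _).1 y.2, map_zero, neg_smul] at h'
      have hx : (x : M) = 0 := half _ (by
        rw [← add_zero (0 : M)]
        nth_rw 1 [← h]
        rw [← h']
        abel)
      rw [hx, zero_add] at h
      have hy : (y : M) = 0 := (smul_eq_zero.1 h).resolve_left hv0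
      exact Prod.ext (Subtype.ext hx) (Subtype.ext hy)
    · intro t
      refine ⟨(⟨(2 : L)⁻¹ • (t + s t), ?_⟩, ⟨(2⁻¹ * v⁻¹ : L) • (t - s t), ?_⟩), ?_⟩
      · rw [hV, hs, map_add, hinv, map_inv₀, map_ofNat, add_comm]
      · rw [hV, hs, map_sub, hinv, map_mul, map_inv₀, map_inv₀, map_ofNat, hv, inv_neg, mul_neg,
          neg_smul, ← smul_neg, neg_sub]
      · rw [hf]
        change (2 : L)⁻¹ • (t + s t) + v • (2⁻¹ * v⁻¹ : L) • (t - s t) = t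
        rw [smul_smul, show v * (2⁻¹ * v⁻¹) = 2⁻¹ by field_simp, ← smul_add,
          show t + s t + (t - s t) = (2 : L) • t by rw [two_smul]; abel, smul_smul,
          inv_mul_cancel₀ h2, one_smul]
  rw [← (LinearEquiv.ofBijective f hbij).finrank_eq, Module.finrank_prod, two_mul]

variable (K L A : Type u) [Field K] [Field L] [Algebra K L] [NeZero (2 : K)]
  [Algebra.IsQuadraticExtension K L] [Ring A] [Algebra L A]

/-- The identity map is bijective and semilinear along `conj`. -/
theorem finrank_conjAlg : Module.finrank L (ConjAlg K L A) = Module.finrank L A := by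
  have h : Module.rank L A = Module.rank L (ConjAlg K L A) :=
    rank_eq_of_equiv_equiv (M := A) (M₁ := ConjAlg K L A) (conj K L) (AddEquiv.refl A)
      (conj K L).bijective fun l a => by
        change l • a = conj K L (conj K L l) • a
        rw [conj_conj]
  rw [Module.finrank, Module.finrank, h]

/-- The switch is a conjugate-linear involution, so its fixed points form a `K`-form of `ᶥA ⊗ A`. -/
theorem finrank_normAlg [FiniteDimensional L A] :
    Module.finrank K (normAlg K L A) = Module.finrank L A ^ 2 := by
  have h1 : Module.finrank L (NormTensor K L A) = Module.finrank L A ^ 2 := by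
    rw [pow_two]
    nth_rw 1 [← finrank_conjAlg K L A]
    exact Module.finrank_tensorProduct (R := L) (M := ConjAlg K L A) (M' := A)
  have h2 := finrank_eq_two_mul_fixed K L (M := NormTensor K L A) (switchAdd K L A)
    (fun l x => by
      rw [Algebra.smul_def, Algebra.smul_def, ← switch_algebraMap]
      exact map_mul (switch K L A) _ _)
    (switch_switch K L) (Subalgebra.toSubmodule (normAlg K L A)) (fun _ => Iff.rfl)
  rw [← Module.finrank_mul_finrank K L, h1, Algebra.IsQuadraticExtension.finrank_eq_two] at h2
  exact (Nat.eq_of_mul_eq_mul_left two_pos h2).symm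

end Dimension

/-! ### Split norm algebras and unitary involutions -/

section Split

/-- A simple algebra of dimension `d ^ 2` with trivial Brauer class is the algebra of `d × d`
matrices. -/
theorem nonempty_algEquiv_matrix_of_matrix {F N : Type*} [Field F] [Ring N] [Algebra F N]
    [IsSimpleRing N] [FiniteDimensional F N] {n m d : ℕ} (hn : n ≠ 0)
    (e : Matrix (Fin n) (Fin n) N ≃ₐ[F] Matrix (Fin m) (Fin m) F)
    (hd : Module.finrank F N = d ^ 2) : Nonempty (N ≃ₐ[F] Matrix (Fin d) (Fin d) F) := by
  have : NeZero n := ⟨hn⟩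
  -- Morita theory by hand: F^m is a module over M_n(N), and the image V of the matrix unit at (0,
  -- 0) is an N-module with F^m ≅ V^n. Comparing dimensions gives dim V = d, so N → End V is an
  -- isomorphism.
  let ρ : Matrix (Fin n) (Fin n) N →ₐ[F] Module.End F (Fin m → F) :=
    (Matrix.toLinAlgEquiv' : Matrix (Fin m) (Fin m) F ≃ₐ[F] _).toAlgHom.comp e.toAlgHom
  let ψ : Fin n → Fin n → N → Module.End F (Fin m → F) := fun i j x => ρ (Matrix.single i j x)
  have hψ : ∀ i j k x y v, ψ i j x (ψ j k y v) = ψ i k (x * y) v := by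
    intro i j k x y v
    change (ρ _ * ρ _) v = _
    rw [← map_mul, Matrix.single_mul_single_same]
  have hψ0 : ∀ i j k l x y v, j ≠ k → ψ i j x (ψ k l y v) = 0 := by
    intro i j k l x y v h
    change (ρ _ * ρ _) v = _
    rw [← map_mul, Matrix.single_mul_single_of_ne _ _ _ _ h, map_zero]
    rfl
  let V : Submodule F (Fin m → F) := LinearMap.range (ψ 0 0 1)
  have hV : ∀ j x v, ψ 0 j x v ∈ V := fun j x v => ⟨ψ 0 j x v, by rw [hψ, one_mul]⟩
  have hV1 : ∀ v ∈ V, ψ 0 0 1 v = v := by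
    rintro _ ⟨w, rfl⟩
    rw [hψ, one_mul]
  let E : (Fin n → V) ≃ₗ[F] (Fin m → F) :=
    { toFun := fun x => ∑ i, ψ i 0 1 (x i)
      map_add' := fun x y => by simp [Finset.sum_add_distrib]
      map_smul' := fun c x => by simp [Finset.smul_sum]
      invFun := fun y i => ⟨ψ 0 i 1 y, hV i 1 y⟩
      left_inv := fun x => by
        ext1 i
        apply Subtype.ext
        change ψ 0 i 1 (∑ j, ψ j 0 1 (x j)) = x i
        rw [map_sum, Finset.sum_eq_single i, hψ, one_mul, hV1 _ (x i).2]
        · intro j _ hj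
          exact hψ0 _ _ _ _ _ _ _ hj.symm
        · simp
      right_inv := fun y => by
        change ∑ i, ψ i 0 1 (ψ 0 i 1 y) = y
        simp only [hψ, one_mul]
        have : ∑ i, ψ i i 1 = 1 := by
          rw [← map_one ρ, ← map_sum, Matrix.sum_single_one]
        rw [← LinearMap.sum_apply, this]
        rfl }
  have h1 : n * Module.finrank F V = m := by
    simpa [Module.finrank_pi_fintype] using E.finrank_eq
  have h2 : n * n * d ^ 2 = m * m := by
    simpa [Module.finrank_matrix, hd] using e.toLinearEquiv.finrank_eq
  have h3 : Module.finrank F V = d := by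
    have : (n * Module.finrank F V) ^ 2 = (n * d) ^ 2 := by rw [h1]; linarith
    exact Nat.eq_of_mul_eq_mul_left (Nat.pos_of_ne_zero hn)
      (Nat.pow_left_injective two_ne_zero this)
  have hd0 : 0 < Module.finrank F V := by
    have : 0 < Module.finrank F N := Module.finrank_pos
    rw [h3]
    exact Nat.pos_of_ne_zero fun h => by simp [hd, h] at this
  have : Nontrivial V := Module.nontrivial_of_finrank_pos hd0
  let f : N →ₐ[F] Module.End F V :=
    { toFun := fun x => (ψ 0 0 x).restrict fun v _ => hV 0 x v
      map_one' := by
        ext1 v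
        exact Subtype.ext (hV1 v v.2)
      map_mul' := fun x y => by
        ext1 v
        exact Subtype.ext (hψ 0 0 0 x y v).symm
      map_zero' := by
        ext1 v
        apply Subtype.ext
        change ρ (Matrix.single 0 0 0) v = 0
        rw [Matrix.single_zero, map_zero]
        rfl
      map_add' := fun x y => by
        ext1 v
        apply Subtype.ext
        change ρ (Matrix.single 0 0 (x + y)) v = ρ _ v + ρ _ v
        rw [Matrix.single_add, map_add]
        rfl
      commutes' := fun c => by
        ext1 v
        apply Subtype.ext
        change ρ (Matrix.single 0 0 (algebraMap F N c)) v = c • v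
        rw [Algebra.algebraMap_eq_smul_one, ← Matrix.smul_single, map_smul]
        change c • ψ 0 0 1 v = _
        rw [hV1 v v.2] }
  have hEnd : Module.finrank F (Module.End F V) = d ^ 2 := by
    rw [Module.finrank_linearMap, h3, pow_two]
  let g : N ≃ₐ[F] Module.End F V :=
    algEquivOfFinrankEq (B := Module.End F V) f (hd.trans hEnd.symm)
  exact ⟨g.trans (LinearMap.toMatrixAlgEquiv (Module.finBasisOfFinrankEq F V h3))⟩

variable {K L A : Type u} [Field K] [Field L] [Algebra K L] [NeZero (2 : K)]
  [Algebra.IsQuadraticExtension K L] [Ring A] [Algebra L A]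

/-- The action `(x ⊗ y) z = y * z * τ x` of the norm tensor product on `A`. -/
noncomputable def IsUnitaryInvolution.action {τ : A →+ A} (h : IsUnitaryInvolution K L τ) :
    NormTensor K L A →ₐ[L] Module.End L A :=
  Algebra.TensorProduct.lift (A := ConjAlg K L A) (B := A)
    -- Right multiplication and τ both reverse products, so the composite is a homomorphism. It is
    -- `L`-linear because τ undoes the twist of scalars in `ᶥA`.
    { toFun := fun x => LinearMap.mulRight L (τ x)
      map_one' := by
        have h1 : τ 1 = 1 := by simpa using h.map_algebraMap 1
        ext z
        change z * τ 1 = z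
        rw [h1, mul_one]
      map_mul' := fun x y => by
        ext z
        exact (congrArg (z * ·) (h.map_mul x y)).trans (mul_assoc z (τ y) (τ x)).symm
      map_zero' := by
        ext z
        change z * τ 0 = 0
        rw [map_zero, mul_zero]
      map_add' := fun x y => by
        ext z
        exact (congrArg (z * ·) (map_add τ x y)).trans (mul_add z (τ x) (τ y))
      commutes' := fun l => by
        ext z
        change z * τ (algebraMap L A (conj K L l)) = l • z
        rw [h.map_algebraMap, conj_conj, ← Algebra.commutes, Algebra.smul_def] }
    (Algebra.lmul L A)
    (fun x y => by
      ext z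
      exact mul_assoc y z (τ x))

theorem IsUnitaryInvolution.action_ntmul {τ : A →+ A} (h : IsUnitaryInvolution K L τ)
    (x y z : A) : h.action (ntmul K L x y) z = y * z * τ x := rfl

/-- On pure tensors, τ (y z τ(x)) = x τ(z) τ(y). Consequently elements of the norm algebra preserve
the fixed points of τ. -/
theorem IsUnitaryInvolution.map_action {τ : A →+ A} (h : IsUnitaryInvolution K L τ)
    (t : NormTensor K L A) (z : A) : τ (h.action t z) = h.action (switch K L A t) (τ z) := by
  induction t using NormTensor.induction with
  | h0 => simp
  | h1 x y =>
    rw [switch_ntmul, h.action_ntmul, h.action_ntmul, h.map_mul, h.map_mul, h.involutive,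
      mul_assoc]
  | h2 x y hx hy =>
    rw [map_add, map_add, map_add, LinearMap.add_apply, LinearMap.add_apply, map_add, hx, hy]

/-- The norm algebra of a central simple algebra with a unitary involution is split. -/
theorem IsUnitaryInvolution.nonempty_normAlg [FiniteDimensional L A] [Algebra.IsCentral L A] [IsSimpleRing A]
    [Algebra K A] [IsScalarTower K L A] {τ : A →+ A} (h : IsUnitaryInvolution K L τ) :
    Nonempty (normAlg K L A ≃ₐ[K]
      Matrix (Fin (Module.finrank L A)) (Fin (Module.finrank L A)) K) := by
  have : FiniteDimensional K A := Module.Finite.trans L A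
  have hK : ∀ (k : K) (x : A), τ (k • x) = k • τ x := fun k x => by
    rw [← algebraMap_smul L k x, h.map_smul, AlgEquiv.commutes, algebraMap_smul]
  let V : Submodule K A :=
    { carrier := {x | τ x = x}
      zero_mem' := map_zero τ
      add_mem' := fun {x y} hx hy => by
        change τ (x + y) = x + y
        rw [map_add, hx, hy]
      smul_mem' := fun k x hx => by
        change τ (k • x) = k • x
        rw [hK, hx] }
  have hV : ∀ x, x ∈ V ↔ τ x = x := fun _ => Iff.rfl
  have hdim : Module.finrank K V = Module.finrank L A := by
    have h2 := finrank_eq_two_mul_fixed K L τ h.map_smul h.involutive V hV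
    rw [← Module.finrank_mul_finrank K L, Algebra.IsQuadraticExtension.finrank_eq_two] at h2
    exact (Nat.eq_of_mul_eq_mul_left two_pos h2).symm
  have : Nontrivial V := by
    refine Module.nontrivial_of_finrank_pos (R := K) ?_
    rw [hdim]
    exact Module.finrank_pos
  -- Source and target both have `K`-dimension (dim_L A)², and the source is simple.
  let f : normAlg K L A →ₐ[K] Module.End K V :=
    { toFun := fun t => ((h.action t.1).restrictScalars K).restrict (p := V) (q := V)
        fun z hz => by
          rw [hV] at hz ⊢
          change τ (h.action t.1 z) = h.action t.1 z
          rw [h.map_action, (mem_normAlg K L _).1 t.2, hz]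
      map_one' := by
        ext1 z
        apply Subtype.ext
        change h.action 1 z = z
        rw [map_one]
        rfl
      map_mul' := fun x y => by
        ext1 z
        apply Subtype.ext
        exact LinearMap.congr_fun (_root_.map_mul h.action x.1 y.1) (z : A)
      map_zero' := by
        ext1 z
        apply Subtype.ext
        change h.action 0 z = 0
        rw [map_zero]
        rfl
      map_add' := fun x y => by
        ext1 z
        apply Subtype.ext
        change h.action (x.1 + y.1) z = h.action x.1 z + h.action y.1 z
        rw [map_add]
        rfl
      commutes' := fun k => by
        ext1 z
        apply Subtype.ext
        change h.action (algebraMap L _ (algebraMap K L k)) z = k • (z : A)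
        rw [AlgHom.commutes, ← algebraMap_smul L k (z : A)]
        rfl }
  have hEnd : Module.finrank K (Module.End K V) = Module.finrank L A ^ 2 := by
    rw [Module.finrank_linearMap, hdim, pow_two]
  let g : normAlg K L A ≃ₐ[K] Module.End K V :=
    algEquivOfFinrankEq (B := Module.End K V) f ((finrank_normAlg K L A).trans hEnd.symm)
  exact ⟨g.trans (LinearMap.toMatrixAlgEquiv (Module.finBasisOfFinrankEq K V hdim))⟩

/-- A division algebra whose norm algebra is split has a unitary involution. -/
theorem exists_isUnitaryInvolution [FiniteDimensional L A] [Nontrivial A] (hdiv : ∀ x : A, x ≠ 0 → IsUnit x)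
    (e : normAlg K L A ≃ₐ[K]
      Matrix (Fin (Module.finrank L A)) (Fin (Module.finrank L A)) K) :
    ∃ τ : A →+ A, IsUnitaryInvolution K L τ := by
  have : NeZero (Module.finrank L A) := ⟨Module.finrank_pos.ne'⟩
  -- The matrix units of the first column: they span the left ideal generated by the idempotent ε =
  -- u 0 in the norm algebra.
  let u : Fin (Module.finrank L A) → NormTensor K L A := fun k => (e.symm (Matrix.single k 0 1)).1
  set ε := u 0 with hε
  have hε0 : ε ≠ 0 := fun h0 => by
    have h1 : e.symm (Matrix.single 0 0 1) = 0 := Subtype.ext h0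
    rw [map_eq_zero_iff _ e.symm.injective] at h1
    simpa using congrFun (congrFun h1 0) 0
  have hεs : switch K L A ε = ε := (e.symm (Matrix.single 0 0 1)).2
  let S : Submodule L (NormTensor K L A) := Submodule.span L (Set.range u)
  have hfix : ∀ x : normAlg K L A, (x : NormTensor K L A) * ε ∈ S := by
    intro x
    have h1 : e x * Matrix.single 0 0 1 = ∑ k, e x k 0 • Matrix.single k 0 (1 : K) := by
      ext i j
      rw [Matrix.sum_apply]
      by_cases hj : j = 0
      · subst hj
        simp [Matrix.single_apply]
      · rw [Matrix.mul_single_apply_of_ne _ _ _ _ _ hj]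
        simp [Ne.symm hj]
    have h2 : x * e.symm (Matrix.single 0 0 1) = ∑ k, e x k 0 • e.symm (Matrix.single k 0 1) := by
      apply e.injective
      rw [map_mul, e.apply_symm_apply, h1, map_sum]
      simp only [map_smul, e.apply_symm_apply]
    have h3 : (x : NormTensor K L A) * ε = ∑ k, e x k 0 • u k := by
      have := congrArg (normAlg K L A).val h2
      rw [map_mul, map_sum] at this
      exact this
    rw [h3]
    refine Submodule.sum_mem _ fun k _ => ?_
    rw [← algebraMap_smul L]
    exact S.smul_mem _ (Submodule.subset_span ⟨k, rfl⟩)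
  -- Writing t = x + v y with x and y in the norm algebra extends `hfix` to all t. The whole left
  -- ideal of ε thus lies in the `L`-span of d = dim_L A elements.
  have hS : ∀ t : NormTensor K L A, t * ε ∈ S := by
    intro t
    obtain ⟨v, hv0, hv⟩ := exists_conj_eq_neg K L
    obtain ⟨x, hx, y, hy, rfl⟩ := decomp K L v hv0 hv t
    rw [add_mul, ← Algebra.smul_def, smul_mul_assoc]
    exact S.add_mem (hfix ⟨x, hx⟩) (S.smul_mem _ (hfix ⟨y, hy⟩))
  let ι : A →ₐ[L] NormTensor K L A :=
    Algebra.TensorProduct.includeRight (R := L) (A := ConjAlg K L A) (B := A)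
  have hι : ∀ b, ι b = ntmul K L 1 b := fun _ => rfl
  let f : A →ₗ[L] NormTensor K L A := (LinearMap.mulRight L ε).comp ι.toLinearMap
  have hf : ∀ b, f b = ntmul K L 1 b * ε := fun _ => rfl
  -- A nonzero b is a unit, so 1 ⊗ b cannot kill ε. The image of f therefore has dimension d and
  -- must fill S.
  have hinj : Function.Injective f := by
    rw [← LinearMap.ker_eq_bot, LinearMap.ker_eq_bot']
    intro b hb
    by_contra hb0
    exact hε0 (((hdiv b hb0).map ι).mul_right_eq_zero.1 hb)
  have hrange : LinearMap.range f = S := by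
    refine Submodule.eq_of_le_of_finrank_le ?_ ?_
    · rintro _ ⟨b, rfl⟩
      exact hS _
    · rw [LinearMap.finrank_range_of_inj hinj]
      exact (finrank_range_le_card u).trans_eq (Fintype.card_fin _)
  have hex : ∀ a : A, ∃ b : A, ntmul K L 1 b * ε = ntmul K L a 1 * ε := by
    intro a
    have : ntmul K L a 1 * ε ∈ LinearMap.range f := hrange ▸ hS _
    exact this
  choose τ hτ using hex
  have huniq : ∀ a b : A, ntmul K L a 1 * ε = ntmul K L 1 b * ε → τ a = b := fun a b hab =>
    hinj ((hτ a).trans hab)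
  have hswap : ∀ a b : A, ntmul K L a 1 * ntmul K L 1 b = ntmul K L 1 b * ntmul K L a 1 := by
    intro a b
    simp only [ntmul_mul_ntmul, one_mul, mul_one]
  refine ⟨AddMonoidHom.mk' τ fun a b => huniq _ _ ?_, fun a b => huniq _ _ ?_,
    fun l => huniq _ _ ?_, fun a => huniq _ _ ?_⟩
  · have h1 : ntmul K L (a + b) 1 = ntmul K L a 1 + ntmul K L b 1 :=
      TensorProduct.add_tmul (R := L) (M := ConjAlg K L A) (N := A) a b 1
    rw [h1, add_mul, ← hτ, ← hτ, ← hι, ← hι, ← hι, map_add, add_mul]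
  -- Since a ⊗ 1 and 1 ⊗ τ b commute, (ab ⊗ 1) ε = (a ⊗ 1)(1 ⊗ τ b) ε = (1 ⊗ τ b)(a ⊗ 1) ε = (1 ⊗ τ
  -- b τ a) ε.
  · have h1 : ntmul K L (a * b) 1 = ntmul K L a 1 * ntmul K L b 1 := by
      rw [ntmul_mul_ntmul, mul_one]
    change _ = ntmul K L 1 (τ b * τ a) * ε
    rw [← hι, map_mul, hι, hι, h1, mul_assoc, ← hτ b, ← mul_assoc, hswap, mul_assoc, ← hτ a,
      mul_assoc]
  · rw [← algebraMap_normTensor, algebraMap_normTensor', conj_conj]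
  -- The switch fixes ε, so it turns the equation defining τ a into the one saying τ (τ a) = a.
  · have h1 := congrArg (switch K L A) (hτ a)
    rw [map_mul, map_mul, switch_ntmul, switch_ntmul, hεs] at h1
    exact h1

end Split

/-! ### Passage to Brauer classes -/

section Brauer

variable {K L : Type u} [Field K] [Field L] [Algebra K L] [NeZero (2 : K)]
  [Algebra.IsQuadraticExtension K L]

/-- The canonical involution of a quaternion algebra defined over `K`, composed with the conjugation
of the coefficients. -/
noncomputable def conjStar (a b : K) :
    QuaternionAlgebra L (algebraMap K L a) 0 (algebraMap K L b) →+
      QuaternionAlgebra L (algebraMap K L a) 0 (algebraMap K L b) where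
  toFun x := ⟨conj K L x.re, -conj K L x.imI, -conj K L x.imJ, -conj K L x.imK⟩
  map_zero' := by ext <;> simp
  map_add' x y := by ext <;> simp [add_comm]

/-- Quaternion conjugation reverses products, and conjugating coefficients is multiplicative because
the structure constants come from `K`. -/
theorem isUnitaryInvolution_conjStar (a b : K) :
    IsUnitaryInvolution K L (conjStar (L := L) a b) where
  map_mul x y := by
    ext <;> simp [conjStar] <;> ring
  map_algebraMap l := by
    rw [QuaternionAlgebra.algebraMap_eq, QuaternionAlgebra.algebraMap_eq]
    ext <;> simp [conjStar]
  involutive x := by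
    ext <;> simp [conjStar, conj_conj]

/-- Brauer equivalence with F only says M_n(N) ≅ M_m(F); the known dimension of N allows the
matrices to be cancelled. -/
theorem brauerClass_eq_zero_iff {F N : Type u} [Field F] [Ring N] [Algebra F N]
    [Algebra.IsCentral F N] [IsSimpleRing N] [FiniteDimensional F N] {d : ℕ}
    (hd : Module.finrank F N = d ^ 2) :
    brauerClass F N = 0 ↔ Nonempty (N ≃ₐ[F] Matrix (Fin d) (Fin d) F) := by
  constructor
  · intro h
    obtain ⟨n, m, hn, -, ⟨e⟩⟩ : IsBrauerEquivalent (csaOf F N) (csaOf F F) := Quotient.exact h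
    exact nonempty_algEquiv_matrix_of_matrix hn e hd
  · rintro ⟨e⟩
    have hd0 : d ≠ 0 := by
      rintro rfl
      exact (Module.finrank_pos (R := F) (M := N)).ne' (by simpa using hd)
    have e₁ : Matrix (Fin 1) (Fin 1) N ≃ₐ[F] N := by
      convert Matrix.uniqueAlgEquiv (m := Fin 1) (R := F) (A := N)
    exact Quotient.sound
      (show IsBrauerEquivalent (csaOf F N) (csaOf F F) from
        ⟨1, d, one_ne_zero, hd0, ⟨e₁.trans e⟩⟩)

theorem mk_eq_mk_of_algEquiv {F : Type u} [Field F] {A B : CSA.{u, u} F} (e : A ≃ₐ[F] B) :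
    Quotient.mk (Brauer.CSA_Setoid F) A = Quotient.mk (Brauer.CSA_Setoid F) B :=
  Quotient.sound (show IsBrauerEquivalent A B from
    ⟨1, 1, one_ne_zero, one_ne_zero, ⟨e.mapMatrix⟩⟩)

/-- A quaternion algebra with split norm algebra is obtained by base change. -/
theorem exists_algEquiv_of_normAlg {a b : L} (ha : a ≠ 0) (hb : b ≠ 0)
    (h : Nonempty (normAlg K L (QuaternionAlgebra L a 0 b) ≃ₐ[K] Matrix (Fin 4) (Fin 4) K)) :
    ∃ c d : K, c ≠ 0 ∧ d ≠ 0 ∧ Nonempty (QuaternionAlgebra L a 0 b ≃ₐ[L]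
      QuaternionAlgebra L (algebraMap K L c) 0 (algebraMap K L d)) := by
  have : NeZero (2 : L) := ⟨two_ne_zero_top K L⟩
  have := isSimpleRing_quaternion ha hb
  have h4 : Module.finrank L (QuaternionAlgebra L a 0 b) = 4 :=
    QuaternionAlgebra.finrank_eq_four _ _ _
  by_cases hdiv : ∀ x : QuaternionAlgebra L a 0 b, x ≠ 0 → IsUnit x
  · rw [← h4] at h
    obtain ⟨e⟩ := h
    obtain ⟨τ, hτ⟩ := exists_isUnitaryInvolution hdiv e
    exact hτ.exists_descent ha hdiv
  -- Here A is the matrix algebra, which is (1, 1) over `L` and so descends with both constants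
  -- equal to 1.
  · push Not at hdiv
    obtain ⟨x, hx0, hx⟩ := hdiv
    obtain ⟨e⟩ := nonempty_algEquiv_matrix_two h4 x hx0 hx
    obtain ⟨e'⟩ := nonempty_quaternion_one_one (F := L)
    refine ⟨1, 1, one_ne_zero, one_ne_zero, ?_⟩
    rw [map_one]
    exact ⟨e.trans e'.symm⟩

end Brauer

end BrauerCores

theorem lemma2p2 {K L : Type u} [Field K] [Field L] [Algebra K L] [NeZero (2 : K)]
    [Algebra.IsQuadraticExtension K L] (α : BrauerGroup.{u, u} L)
    (hα : BrauerCores.IsQuaternionClass L α) :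
    BrauerCores.cores K L α = 0 ↔
      ∃ β : BrauerGroup.{u, u} K, BrauerCores.IsQuaternionClass K β ∧
        α = BrauerCores.res K L β := by
  open BrauerCores in
  have : NeZero (2 : L) := ⟨two_ne_zero_top K L⟩
  constructor
  · obtain ⟨A, ⟨a, b, ha, hb, ⟨e⟩⟩, rfl⟩ := hα
    intro h
    have h4 : Module.finrank L A = 4 := by
      rw [e.toLinearEquiv.finrank_eq, QuaternionAlgebra.finrank_eq_four]
    -- The norm algebra has dimension 4², so a trivial class makes it the algebra of 4 × 4 matrices.
    obtain ⟨eN⟩ := (brauerClass_eq_zero_iff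
      (by rw [finrank_normAlg, h4])).1 (show brauerClass K (normAlg K L A) = 0 from h)
    obtain ⟨c, d, hc, hd, ⟨e'⟩⟩ := exists_algEquiv_of_normAlg ha hb
      ⟨(normAlgCongr K L e).symm.trans eN⟩
    have := isSimpleRing_quaternion hc hd
    have := isCentral_quaternion (b := d) hc
    obtain ⟨e''⟩ := nonempty_baseChange_quaternion (L := L) hc hd
    exact ⟨brauerClass K (QuaternionAlgebra K c 0 d),
      ⟨csaOf K (QuaternionAlgebra K c 0 d), ⟨c, d, hc, hd, ⟨AlgEquiv.refl⟩⟩, rfl⟩,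
      mk_eq_mk_of_algEquiv
        (B := csaOf L (L ⊗[K] QuaternionAlgebra K c 0 d)) ((e.trans e').trans e''.symm)⟩
  · rintro ⟨_, ⟨B, ⟨a, b, ha, hb, ⟨e⟩⟩, rfl⟩, rfl⟩
    change brauerClass K (normAlg K L (L ⊗[K] B)) = 0
    have ha' := (map_ne_zero (algebraMap K L)).2 ha
    have hb' := (map_ne_zero (algebraMap K L)).2 hb
    have := isSimpleRing_quaternion ha' hb'
    have := isCentral_quaternion (b := algebraMap K L b) ha'
    obtain ⟨e'⟩ := nonempty_baseChange_quaternion (L := L) ha hb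
    let e₁ : L ⊗[K] B ≃ₐ[L] QuaternionAlgebra L (algebraMap K L a) 0 (algebraMap K L b) :=
      (Algebra.TensorProduct.congr AlgEquiv.refl e).trans e'
    obtain ⟨e₂⟩ := (isUnitaryInvolution_conjStar (L := L) a b).nonempty_normAlg
    refine (brauerClass_eq_zero_iff ?_).2 ⟨(normAlgCongr K L e₁).trans e₂⟩
    rw [finrank_normAlg, e₁.toLinearEquiv.finrank_eq]
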